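/- Let $g,\sigma>0$, let $\kappa=[\![\gamma]\!]\in\mathbb R$ with $-1\le \kappa/\sigma\le 1$, and let $\theta_1,\theta_2\in(0,\pi)$ with $\theta_1+\theta_2<\pi$. Let $\gamma\in[-\frac\pi2,\frac\pi2]$ be given by $\sin\gamma=-\kappa/\sigma$, and put $$\psi_1=\gamma+\tfrac{\pi}{2}-\theta_1,\qquad \psi_2=-\gamma-\tfrac{\pi}{2}+\theta_2 .$$ Assume $\psi_1>0>\psi_2$. For $x_m,u_m\in\mathbb R$, a *shifted free-surface curve with data* $(x_m,u_m)$ is a curve $(x(\psi),y(\psi))$, $\psi\in[\psi_2,\psi_1]$, with $y\ne 0$ along the curve and $$\frac{dx}{d\psi}=\sigma\frac{\cos\psi}{gy},\qquad \frac{dy}{d\psi}=\sigma\frac{\sin\psi}{gy},\qquad x(0)=x_m,\qquad y(0)=u_m=\sup_{\psi_2\le\psi\le\psi_1}y(\psi).$$ For $P_0\in\mathbb R$ let $O=(0,-P_0/g)$. The left and the right wall are the rays from $O$ with directions $(-\cos\theta_1,\sin\theta_1)$ and $(\cos\theta_2,\sin\theta_2)$. The curve *meets the walls with corner $O$* if $(x(\psi_1),y(\psi_1))$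 lies on the left wall and $(x(\psi_2),y(\psi_2))$ on the right wall, both different from $O$. The enclosed volume is then the area (Lebesgue measure) of the region enclosed by the curve and the two wall segments from $O$ to the contact points, that is, of the set of points off this closed contour whose connected component in its complement is bounded. **Theorem.** 1. A shifted free-surface curve with data $(x_m,u_m)$ exists if and only if $u_m<0$, and it is then unique. 2. There are functions $X,P_0,\mathscr V$ of $u_m\in(-\infty,0)$, with $\mathscr V>0$, such that a shifted free-surface curve with data $(x_m,u_m)$ meets the walls with corner $(0,-P/g)$ if and only if $x_m=X(u_m)$ and $P=P_0(u_m)$, and in this case the enclosed volume is finite and equals $\mathscr V(u_m)$. 3. $\displaystyle\lim_{u_m\to0^-}\mathscr V(u_m)=+\infty$ and $\displaystyle\lim_{u_m\to-\infty}\mathscr V(u_m)=0.$ 4. For every $V>0$ there is $u_m<0$ with $\mathscr V(u_m)=V$, together with a shifted free-surface curve $(x,y)$ with data $(X(u_m),u_m)$ that meets the walls with corner $(0,-P_0(u_m)/g)$ and encloses the volume $V$. Moreover, with $P_0=P_0(u_m)$, the curve $(x,\,y+P_0/g)$ solves $$\frac{dx}{d\psi}=\sigma\frac{\cos\psi}{gy-P_0},\qquad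 \frac{dy}{d\psi}=\sigma\frac{\sin\psi}{gy-P_0}$$ on $[\psi_2,\psi_1]$ and meets, at $\psi=\psi_1$ and $\psi=\psi_2$, the left and the right wall with corner $(0,0)$. 5. If $\kappa<0$, then $\mathscr V$ is strictly increasing on $(-\infty,0)$. Consequently, for every $V>0$ the data $u_m$ and $x_m$, the constant $P_0$ and the shifted free-surface curve that meets the walls with corner $(0,-P_0/g)$ and encloses the volume $V$ are unique. -/

import Mathlib

open Set Filter Topology MeasureTheory

namespace Capillary

/-- The angle `γ ∈ [-π/2, π/2]` with `sin γ = -κ / σ`, where `κ` is the jump `⟦γ⟧` of the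
free-energy densities and `σ` the surface tension. -/
noncomputable def contactGamma (σ κ : ℝ) : ℝ := Real.arcsin (-κ / σ)

/-- The slope angle `ψ₁ = γ + π/2 - θ₁` prescribed at the left wall. -/
noncomputable def leftAngle (σ κ θ₁ : ℝ) : ℝ := contactGamma σ κ + Real.pi / 2 - θ₁

/-- The slope angle `ψ₂ = -γ - π/2 + θ₂` prescribed at the right wall. -/
noncomputable def rightAngle (σ κ θ₂ : ℝ) : ℝ := -contactGamma σ κ - Real.pi / 2 + θ₂

/-- The prescribed angle at the left wall in terms of `κ / σ`. -/
theorem sin_leftAngle (σ κ θ₁ : ℝ) (h : κ / σ ∈ Icc (-1 : ℝ) 1) :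
    Real.sin (leftAngle σ κ θ₁)
      = (-(κ / σ)) * Real.sin θ₁ + Real.sqrt (1 - κ ^ 2 / σ ^ 2) * Real.cos θ₁ := by
  have h1 : -1 ≤ -κ / σ := by rw [neg_div]; linarith [h.2]
  have h2 : -κ / σ ≤ 1 := by rw [neg_div]; linarith [h.1]
  have e : Real.sin (leftAngle σ κ θ₁) = Real.cos (θ₁ - contactGamma σ κ) := by
    rw [← Real.sin_pi_div_two_sub]; unfold leftAngle; congr 1; ring
  rw [e, Real.cos_sub]
  unfold contactGamma
  rw [Real.sin_arcsin h1 h2, Real.cos_arcsin, div_pow, neg_sq, neg_div]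
  ring

/-- The prescribed angle at the right wall in terms of `κ / σ`. -/
theorem sin_rightAngle (σ κ θ₂ : ℝ) (h : κ / σ ∈ Icc (-1 : ℝ) 1) :
    Real.sin (rightAngle σ κ θ₂)
      = (κ / σ) * Real.sin θ₂ - Real.sqrt (1 - κ ^ 2 / σ ^ 2) * Real.cos θ₂ := by
  have e : rightAngle σ κ θ₂ = -leftAngle σ κ θ₂ := by unfold rightAngle leftAngle; ring
  rw [e, Real.sin_neg, sin_leftAngle σ κ θ₂ h]
  ring

/-- The curve `(x, y)`, parametrized by its slope angle `ψ ∈ [ψ₂, ψ₁]`, solves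
`dx/dψ = σ cos ψ / (g y - P)`, `dy/dψ = σ sin ψ / (g y - P)`, the denominator being nonzero along
the curve. For `P = 0` this is the vertically shifted system. -/
def SolvesSurfaceODE (g σ P ψ₁ ψ₂ : ℝ) (x y : ℝ → ℝ) : Prop :=
  ∀ ψ ∈ Icc ψ₂ ψ₁,
    g * y ψ - P ≠ 0 ∧
    HasDerivWithinAt x (σ * Real.cos ψ / (g * y ψ - P)) (Icc ψ₂ ψ₁) ψ ∧
    HasDerivWithinAt y (σ * Real.sin ψ / (g * y ψ - P)) (Icc ψ₂ ψ₁) ψ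

/-- A shifted free-surface curve with data `(xm, um)`: it solves the shifted system, passes
through `(xm, um)` at `ψ = 0`, and `um` is the supremum of its height. -/
structure IsShiftedCurve (g σ ψ₁ ψ₂ xm um : ℝ) (x y : ℝ → ℝ) : Prop where
  ode : SolvesSurfaceODE g σ 0 ψ₁ ψ₂ x y
  x_zero : x 0 = xm
  y_zero : y 0 = um
  isLUB : IsLUB (y '' Icc ψ₂ ψ₁) um

/-- The walls are the two rays issuing from the corner `O = (0, c)`: the left one makes the angle
`θ₁` and the right one the angle `θ₂` with the horizontal. The curve meets the left wall at
`ψ = ψ₁` and the right wall at `ψ = ψ₂`. -/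
def MeetsWalls (θ₁ θ₂ ψ₁ ψ₂ c : ℝ) (x y : ℝ → ℝ) : Prop :=
  (∃ t > 0, x ψ₁ = -(t * Real.cos θ₁) ∧ y ψ₁ = c + t * Real.sin θ₁) ∧
  (∃ t > 0, x ψ₂ = t * Real.cos θ₂ ∧ y ψ₂ = c + t * Real.sin θ₂)

/-- The points enclosed by a plane set `C`: those off `C` whose connected component in the
complement of `C` is bounded. -/
def enclosed (C : Set (ℝ × ℝ)) : Set (ℝ × ℝ) :=
  {p | p ∉ C ∧ Bornology.IsBounded (connectedComponentIn Cᶜ p)}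

/-- The closed curve made of the free surface and the parts of the two walls between the corner
`(0, c)` and the contact points. -/
def closedContour (ψ₁ ψ₂ c : ℝ) (x y : ℝ → ℝ) : Set (ℝ × ℝ) :=
  (fun ψ => (x ψ, y ψ)) '' Icc ψ₂ ψ₁
    ∪ segment ℝ (0, c) (x ψ₁, y ψ₁) ∪ segment ℝ (0, c) (x ψ₂, y ψ₂)

/-- The fluid region `Ω`, enclosed by the free surface and the two walls. -/
def fluidRegion (ψ₁ ψ₂ c : ℝ) (x y : ℝ → ℝ) : Set (ℝ × ℝ) :=
  enclosed (closedContour ψ₁ ψ₂ c x y)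

end Capillary

/-!
Only the angles enter the geometry, through the relation `θ₂ - ψ₂ = θ₁ + ψ₁ ∈ (0, π]` (`Wedge`): the
curve makes the same angle with both walls.

The equation for the height integrates to `y² = um² + (2 σ / g) (1 - cos ψ)`. A curve that is highest
at `ψ = 0` must have `y < 0`, so that its radius of curvature is the explicit function
`radius g σ um` of the slope angle, and the curve is determined up to translation
(`Wedge.eq_arc_of_isShiftedCurve`). This radius is positive and decreases with the distance of the
slope from the horizontal; everything else is derived for any such profile (`IsProfile`).

Projecting the curve along one wall gives the distance from the corner to the contact point on the
other wall as `∫ lam φ * sin (θ₂ - φ) dφ / sin (θ₁ + θ₂)`. A reflection of the angle about `θ₂` shows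
that it is positive, with a bound uniform in the profile (`Wedge.exists_le_reach`). Hence there is
exactly one position in which the curve meets both walls (`Wedge.meetsWalls_iff`).

The support function `h` of the curve about the corner is positive (`Wedge.arcSupport_pos`), and it
follows that the curve turns strictly counterclockwise about the corner (`Wedge.arc_cross_pos`). The
union of the segments from the corner to the curve is then a compact star-shaped set; its part off
the contour is open by the inverse function theorem, so it is the enclosed region
(`fluidRegion_eq_fan`), and the change of variables `(s, ψ) ↦ s · (x ψ, y ψ)`, taken from the corner,
gives its area `½ ∫ lam ψ * h ψ dψ`.

The map `lam ↦ h` is linear and symmetric (`Wedge.integral_mul_arcSupport_comm`), so the areas of two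
profiles differ by `½ ∫ (lam₂ - lam₁) (h₁ + h₂)`. As the radius of curvature increases with `um`, so
does the volume. Bounding the area above by a multiple of the squared maximum of the radius gives the
limit at `-∞`; bounding it below by a multiple of the integral of the radius near `ψ = 0`, which
diverges logarithmically, gives the limit at `0`. Continuity and the intermediate value theorem do
the rest.
-/

namespace Capillary

/-! ### Regions that are star-shaped about the corner -/

/-- If an open set `U` together with a contour `C` forms a compact set that is star-shaped about a
point of `C`, then `U` is the region enclosed by `C`: it is clopen in `Cᶜ`, and from every point
outside a ray leads away to infinity. -/
theorem enclosed_eq_of_starConvex {C U : Set (ℝ × ℝ)} {O : ℝ × ℝ} (hU : IsOpen U)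
    (hUC : Disjoint U C) (hK : IsCompact (U ∪ C)) (hO : O ∈ C)
    (hstar : StarConvex ℝ O (U ∪ C)) : enclosed C = U := by
  ext p
  constructor
  · rintro ⟨hpC, hbdd⟩
    by_contra hpU
    have hpK : p ∉ U ∪ C := fun h => h.elim hpU hpC
    have hpO : 0 < ‖p - O‖ := by
      rw [norm_pos_iff, sub_ne_zero]
      rintro rfl
      exact hpC hO
    let ray : ℝ → ℝ × ℝ := fun t => O + t • (p - O)
    have hray : IsPreconnected (ray '' Ici 1) :=
      isPreconnected_Ici.image _ (by fun_prop)
    have hsub : ray '' Ici 1 ⊆ Cᶜ := by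
      rintro _ ⟨t, ht, rfl⟩ hC
      have ht1 : (1 : ℝ) ≤ t := ht
      have ht0 : 0 < t := by linarith
      apply hpK
      have := hstar (Or.inr hC) (a := 1 - t⁻¹) (b := t⁻¹)
        (sub_nonneg.2 (inv_le_one_of_one_le₀ ht1)) (inv_nonneg.2 ht0.le) (by ring)
      convert this using 1
      simp only [ray, smul_add, smul_smul, inv_mul_cancel₀ ht0.ne', one_smul, sub_smul]
      abel
    have hp : p ∈ ray '' Ici 1 := ⟨1, self_mem_Ici, by simp [ray]⟩
    obtain ⟨R, hR⟩ :=
      (hbdd.subset (hray.subset_connectedComponentIn hp hsub)).subset_closedBall O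
    have hmem := hR (mem_image_of_mem ray (le_max_left (1 : ℝ) ((R + 1) / ‖p - O‖)))
    rw [mem_closedBall_iff_norm] at hmem
    have h1 : ‖ray (max 1 ((R + 1) / ‖p - O‖)) - O‖
        = max 1 ((R + 1) / ‖p - O‖) * ‖p - O‖ := by
      simp only [ray, add_sub_cancel_left, norm_smul, Real.norm_eq_abs]
      rw [abs_of_pos (lt_of_lt_of_le one_pos (le_max_left _ _))]
    have h2 : R + 1 ≤ max 1 ((R + 1) / ‖p - O‖) * ‖p - O‖ := by
      rw [← div_le_iff₀ hpO]
      exact le_max_right _ _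
    linarith
  · intro hp
    have hpC : p ∉ C := fun h => (disjoint_left.1 hUC) hp h
    refine ⟨hpC, ?_⟩
    have hS : connectedComponentIn Cᶜ p ⊆ U := by
      refine isPreconnected_connectedComponentIn.subset_left_of_subset_union hU
        hK.isClosed.isOpen_compl (disjoint_left.2 fun q hq hq' => hq' (Or.inl hq)) ?_
        ⟨p, mem_connectedComponentIn hpC, hp⟩
      intro q hq
      have hqC : q ∉ C := connectedComponentIn_subset _ _ hq
      by_cases hqU : q ∈ U
      · exact Or.inl hqU
      · exact Or.inr fun h => h.elim hqU hqC
    exact hK.isBounded.subset (hS.trans subset_union_left)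

/-- The fan over the curve `(x, y)` with apex `(0, c)`: `fan c x y (s, ψ)` is the point at the
fraction `s` of the segment from the apex to `(x ψ, y ψ)`. -/
def fan (c : ℝ) (x y : ℝ → ℝ) (p : ℝ × ℝ) : ℝ × ℝ := (p.1 * x p.2, c + p.1 * (y p.2 - c))

/-- The derivative of `fan c x y`, when `x` and `y` have derivatives `x'` and `y'`. -/
noncomputable def fanDeriv (c : ℝ) (x y x' y' : ℝ → ℝ) (p : ℝ × ℝ) : ℝ × ℝ →L[ℝ] ℝ × ℝ :=
  (Matrix.toLin (.finTwoProd ℝ) (.finTwoProd ℝ)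
    !![x p.2, p.1 * x' p.2; y p.2 - c, p.1 * y' p.2]).toContinuousLinearMap

theorem det_fanDeriv (c : ℝ) (x y x' y' : ℝ → ℝ) (p : ℝ × ℝ) :
    (fanDeriv c x y x' y' p).det = p.1 * (x p.2 * y' p.2 - (y p.2 - c) * x' p.2) := by
  unfold fanDeriv
  simp only [LinearMap.det_toContinuousLinearMap, LinearMap.det_toLin, Matrix.det_fin_two_of]
  ring

theorem hasStrictFDerivAt_fan {c : ℝ} {x y x' y' : ℝ → ℝ} {p : ℝ × ℝ}
    (hx : HasStrictDerivAt x (x' p.2) p.2) (hy : HasStrictDerivAt y (y' p.2) p.2) :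
    HasStrictFDerivAt (fan c x y) (fanDeriv c x y x' y' p) p := by
  unfold fanDeriv
  rw [Matrix.toLin_finTwoProd_toContinuousLinearMap]
  have h1 := (hasStrictFDerivAt_fst (𝕜 := ℝ) (p := p)).mul
    (hx.comp_hasStrictFDerivAt p hasStrictFDerivAt_snd)
  have hy' : HasStrictDerivAt (fun ψ => y ψ - c) (y' p.2) p.2 := hy.sub_const c
  have h2 := ((hasStrictFDerivAt_fst (𝕜 := ℝ) (p := p)).mul
    (hy'.comp_hasStrictFDerivAt p hasStrictFDerivAt_snd)).const_add c
  convert! h1.prodMk h2 using 2 <;> simp [smul_smul, add_comm]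

section StarShaped

variable {ψ₁ ψ₂ c : ℝ} {x y x' y' : ℝ → ℝ}

theorem fan_image_union_closedContour (hlt : ψ₂ < ψ₁) :
    fan c x y '' (Ioo 0 1 ×ˢ Ioo ψ₂ ψ₁) ∪ closedContour ψ₁ ψ₂ c x y
      = fan c x y '' (Icc 0 1 ×ˢ Icc ψ₂ ψ₁) := by
  have hseg : ∀ ψ, segment ℝ ((0 : ℝ), c) (x ψ, y ψ) = (fun s => fan c x y (s, ψ)) '' Icc 0 1 := by
    intro ψ
    rw [segment_eq_image']
    refine image_congr fun s _ => ?_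
    simp [fan]
  have h₁ : ψ₁ ∈ Icc ψ₂ ψ₁ := right_mem_Icc.2 hlt.le
  have h₂ : ψ₂ ∈ Icc ψ₂ ψ₁ := left_mem_Icc.2 hlt.le
  have hzero : ∀ ψ, fan c x y (0, ψ) = (0, c) := fun ψ => by simp [fan]
  unfold closedContour
  rw [hseg, hseg]
  apply Subset.antisymm
  · rintro q (⟨p, hp, rfl⟩ | (⟨ψ, hψ, rfl⟩ | ⟨s, hs, rfl⟩) | ⟨s, hs, rfl⟩)
    · exact ⟨p, ⟨Ioo_subset_Icc_self hp.1, Ioo_subset_Icc_self hp.2⟩, rfl⟩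
    · exact ⟨(1, ψ), ⟨by simp, hψ⟩, by simp [fan]⟩
    · exact ⟨(s, ψ₁), ⟨hs, h₁⟩, rfl⟩
    · exact ⟨(s, ψ₂), ⟨hs, h₂⟩, rfl⟩
  · rintro _ ⟨⟨s, ψ⟩, ⟨hs, hψ⟩, rfl⟩
    simp only at hs hψ
    rcases eq_or_lt_of_le hs.1 with h0 | h0
    · subst h0
      exact Or.inr (Or.inr ⟨0, by simp, by simp only [hzero]⟩)
    rcases eq_or_lt_of_le hs.2 with h1 | h1
    · subst h1
      exact Or.inr (Or.inl (Or.inl ⟨ψ, hψ, by simp [fan]⟩))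
    rcases eq_or_lt_of_le hψ.1 with h2 | h2
    · subst h2
      exact Or.inr (Or.inr ⟨s, hs, rfl⟩)
    rcases eq_or_lt_of_le hψ.2 with h3 | h3
    · subst h3
      exact Or.inr (Or.inl (Or.inr ⟨s, hs, rfl⟩))
    exact Or.inl ⟨(s, ψ), ⟨⟨h0, h1⟩, ⟨h2, h3⟩⟩, rfl⟩

/-- A curve that turns strictly counterclockwise about the apex, as expressed by the cross
products of its position vectors, meets every ray from the apex at most once. -/
theorem fan_injOn
    (hcross : ∀ ψ ∈ Icc ψ₂ ψ₁, ∀ φ ∈ Icc ψ₂ ψ₁, ψ < φ →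
      0 < x ψ * (y φ - c) - (y ψ - c) * x φ) (hlt : ψ₂ < ψ₁) :
    InjOn (fan c x y) (Ioi 0 ×ˢ Icc ψ₂ ψ₁) := by
  rintro ⟨s, ψ⟩ ⟨hs, hψ⟩ ⟨t, φ⟩ ⟨ht, hφ⟩ h
  simp only [mem_Ioi] at hs ht hψ hφ
  simp only [fan, Prod.mk.injEq, add_right_inj] at h
  obtain ⟨hx, hy⟩ := h
  have hst : 0 < s * t := mul_pos hs ht
  have key : (s * t) * (x ψ * (y φ - c) - (y ψ - c) * x φ) = 0 := by
    linear_combination (t * (y φ - c)) * hx - (t * x φ) * hy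
  have hψφ : ψ = φ := by
    rcases lt_trichotomy ψ φ with hlt' | heq | hlt'
    · have := mul_pos hst (hcross ψ hψ φ hφ hlt')
      linarith
    · exact heq
    · have := mul_pos hst (hcross φ hφ ψ hψ hlt')
      nlinarith
  subst hψφ
  have hne : x ψ ≠ 0 ∨ y ψ - c ≠ 0 := by
    by_contra! hcon
    rcases eq_or_lt_of_le hψ.2 with h3 | h3
    · have := hcross ψ₂ (left_mem_Icc.2 hlt.le) ψ hψ (by rw [h3]; exact hlt)
      rw [hcon.1, hcon.2] at this
      simp at this
    · have := hcross ψ hψ ψ₁ (right_mem_Icc.2 hlt.le) h3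
      rw [hcon.1, hcon.2] at this
      simp at this
  have : s = t := hne.elim (fun h => mul_right_cancel₀ h hx) (fun h => mul_right_cancel₀ h hy)
  rw [this]

/-- The region enclosed by the closed contour of a curve that turns strictly counterclockwise about
the corner is the open fan over that curve. -/
theorem fluidRegion_eq_fan (hlt : ψ₂ < ψ₁) (hx : ∀ ψ, HasDerivAt x (x' ψ) ψ)
    (hy : ∀ ψ, HasDerivAt y (y' ψ) ψ) (hx' : Continuous x') (hy' : Continuous y')
    (hcross : ∀ ψ ∈ Icc ψ₂ ψ₁, ∀ φ ∈ Icc ψ₂ ψ₁, ψ < φ →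
      0 < x ψ * (y φ - c) - (y ψ - c) * x φ)
    (hdet : ∀ ψ ∈ Ioo ψ₂ ψ₁, 0 < x ψ * y' ψ - (y ψ - c) * x' ψ) :
    fluidRegion ψ₁ ψ₂ c x y = fan c x y '' (Ioo 0 1 ×ˢ Ioo ψ₂ ψ₁) := by
  have hxc : Continuous x := continuous_iff_continuousAt.2 fun ψ => (hx ψ).continuousAt
  have hyc : Continuous y := continuous_iff_continuousAt.2 fun ψ => (hy ψ).continuousAt
  have hfc : Continuous (fan c x y) := by unfold fan; fun_prop
  have hinj : ∀ s ψ t φ, 0 < s → ψ ∈ Icc ψ₂ ψ₁ → 0 < t → φ ∈ Icc ψ₂ ψ₁ →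
      fan c x y (s, ψ) = fan c x y (t, φ) → s = t ∧ ψ = φ := fun s ψ t φ hs hψ ht hφ h =>
    Prod.mk.injEq _ _ _ _ ▸ fan_injOn hcross hlt (mk_mem_prod hs hψ) (mk_mem_prod ht hφ) h
  have hunion := fan_image_union_closedContour (c := c) (x := x) (y := y) hlt
  have hzero : ∀ ψ, fan c x y (0, ψ) = (0, c) := fun ψ => by simp [fan]
  have h₁ : ψ₁ ∈ Icc ψ₂ ψ₁ := right_mem_Icc.2 hlt.le
  have h₂ : ψ₂ ∈ Icc ψ₂ ψ₁ := left_mem_Icc.2 hlt.le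
  refine enclosed_eq_of_starConvex (O := (0, c)) ?_ ?_ ?_ ?_ ?_
  · -- the inverse function theorem makes the fan open
    rw [isOpen_iff_mem_nhds]
    rintro _ ⟨p, hp, rfl⟩
    have hdetp : (fanDeriv c x y x' y' p).det ≠ 0 := by
      rw [det_fanDeriv]
      exact (mul_pos hp.1.1 (hdet _ hp.2)).ne'
    have hstrict : HasStrictFDerivAt (fan c x y)
        ((ContinuousLinearMap.toContinuousLinearEquivOfDetNeZero _ hdetp :
          (ℝ × ℝ) ≃L[ℝ] (ℝ × ℝ)) : (ℝ × ℝ) →L[ℝ] (ℝ × ℝ)) p := by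
      rw [ContinuousLinearMap.coe_toContinuousLinearEquivOfDetNeZero]
      exact hasStrictFDerivAt_fan
        (hasStrictDerivAt_of_hasDerivAt_of_continuousAt (Eventually.of_forall hx)
          hx'.continuousAt)
        (hasStrictDerivAt_of_hasDerivAt_of_continuousAt (Eventually.of_forall hy)
          hy'.continuousAt)
    rw [← hstrict.map_nhds_eq_of_equiv]
    exact image_mem_map ((isOpen_Ioo.prod isOpen_Ioo).mem_nhds hp)
  · rw [disjoint_left]
    rintro _ ⟨⟨s, ψ⟩, ⟨hs, hψ⟩, rfl⟩ hC
    simp only at hs hψ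
    have hψ' : ψ ∈ Icc ψ₂ ψ₁ := Ioo_subset_Icc_self hψ
    have hapex : ∀ t, 0 < t → ∀ φ ∈ Icc ψ₂ ψ₁, fan c x y (t, φ) ≠ (0, c) := by
      intro t ht φ hφ h
      -- doubling the dilation factor would fix the apex as well
      have h2 : fan c x y (2 * t, φ) = fan c x y (t, φ) := by
        rw [h]
        simp only [fan, Prod.mk.injEq] at h ⊢
        exact ⟨by linarith [h.1], by linarith [h.2]⟩
      have := (hinj _ _ _ _ (by linarith) hφ ht hφ h2).1
      linarith
    have hside : ∀ φ ∈ Icc ψ₂ ψ₁, φ ≠ ψ →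
        fan c x y (s, ψ) ∉ segment ℝ ((0 : ℝ), c) (x φ, y φ) := by
      intro φ hφ hne hmem
      rw [segment_eq_image'] at hmem
      obtain ⟨t, ht, h⟩ := hmem
      have h' : fan c x y (t, φ) = fan c x y (s, ψ) := by rw [← h]; simp [fan]
      rcases eq_or_lt_of_le ht.1 with h0 | h0
      · rw [← h0, hzero] at h'
        exact hapex s hs.1 ψ hψ' h'.symm
      · exact hne (hinj _ _ _ _ h0 hφ hs.1 hψ' h').2
    rcases hC with (⟨φ, hφ, h⟩ | h) | h
    · have h' : fan c x y (1, φ) = fan c x y (s, ψ) := by rw [← h]; simp [fan]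
      exact hs.2.ne' (hinj _ _ _ _ one_pos hφ hs.1 hψ' h').1
    · exact hside ψ₁ h₁ hψ.2.ne' h
    · exact hside ψ₂ h₂ hψ.1.ne h
  · rw [hunion]
    exact (isCompact_Icc.prod isCompact_Icc).image hfc
  · exact Or.inr (left_mem_segment _ _ _)
  · rw [hunion]
    rintro _ ⟨⟨s, ψ⟩, ⟨hs, hψ⟩, rfl⟩ a b ha hb hab
    simp only at hs hψ
    refine ⟨(b * s, ψ), ⟨⟨mul_nonneg hb hs.1, ?_⟩, hψ⟩, ?_⟩
    · exact mul_le_one₀ (by linarith) hs.1 hs.2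
    · have : a = 1 - b := by linarith
      subst this
      simp only [fan, Prod.smul_mk, smul_eq_mul, Prod.mk_add_mk, Prod.mk.injEq]
      constructor <;> ring

/-- Area of the region between a curve turning counterclockwise about the corner and the two
segments that join its end points to the corner. -/
theorem volume_fluidRegion_eq (hlt : ψ₂ < ψ₁) (hx : ∀ ψ, HasDerivAt x (x' ψ) ψ)
    (hy : ∀ ψ, HasDerivAt y (y' ψ) ψ) (hx' : Continuous x') (hy' : Continuous y')
    (hcross : ∀ ψ ∈ Icc ψ₂ ψ₁, ∀ φ ∈ Icc ψ₂ ψ₁, ψ < φ →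
      0 < x ψ * (y φ - c) - (y ψ - c) * x φ)
    (hdet : ∀ ψ ∈ Ioo ψ₂ ψ₁, 0 < x ψ * y' ψ - (y ψ - c) * x' ψ) :
    volume (fluidRegion ψ₁ ψ₂ c x y)
      = ENNReal.ofReal (1 / 2 * ∫ ψ in ψ₂..ψ₁, (x ψ * y' ψ - (y ψ - c) * x' ψ)) := by
  have hxc : Continuous x := continuous_iff_continuousAt.2 fun ψ => (hx ψ).continuousAt
  have hyc : Continuous y := continuous_iff_continuousAt.2 fun ψ => (hy ψ).continuousAt
  have hm : MeasurableSet (Ioo (0 : ℝ) 1 ×ˢ Ioo ψ₂ ψ₁) := measurableSet_Ioo.prod measurableSet_Ioo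
  have hsub : Ioo (0 : ℝ) 1 ×ˢ Ioo ψ₂ ψ₁ ⊆ Ioi 0 ×ˢ Icc ψ₂ ψ₁ :=
    prod_mono Ioo_subset_Ioi_self Ioo_subset_Icc_self
  have hcont : Continuous fun ψ => x ψ * y' ψ - (y ψ - c) * x' ψ := by fun_prop
  rw [fluidRegion_eq_fan hlt hx hy hx' hy' hcross hdet,
    ← lintegral_abs_det_fderiv_eq_addHaar_image volume hm
      (f' := fanDeriv c x y x' y') (fun p _ => (hasStrictFDerivAt_fan
        (hasStrictDerivAt_of_hasDerivAt_of_continuousAt (Eventually.of_forall hx)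
          hx'.continuousAt)
        (hasStrictDerivAt_of_hasDerivAt_of_continuousAt (Eventually.of_forall hy)
          hy'.continuousAt)).hasFDerivAt.hasFDerivWithinAt)
      ((fan_injOn hcross hlt).mono hsub)]
  have hcongr : ∫⁻ p in Ioo (0 : ℝ) 1 ×ˢ Ioo ψ₂ ψ₁,
        ENNReal.ofReal |(fanDeriv c x y x' y' p).det|
      = ∫⁻ p in Ioo (0 : ℝ) 1 ×ˢ Ioo ψ₂ ψ₁, ENNReal.ofReal p.1 *
          ENNReal.ofReal (x p.2 * y' p.2 - (y p.2 - c) * x' p.2) := by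
    refine setLIntegral_congr_fun hm fun p hp => ?_
    rw [det_fanDeriv, abs_of_pos (mul_pos hp.1.1 (hdet _ hp.2)), ENNReal.ofReal_mul hp.1.1.le]
  rw [hcongr, Measure.volume_eq_prod, ← Measure.prod_restrict,
    lintegral_prod_mul (f := fun s => ENNReal.ofReal s)
      (g := fun ψ => ENNReal.ofReal (x ψ * y' ψ - (y ψ - c) * x' ψ))
      (by fun_prop) (by fun_prop)]
  have e1 : ∫⁻ s in Ioo (0 : ℝ) 1, ENNReal.ofReal s = ENNReal.ofReal (1 / 2) := by
    rw [← ofReal_integral_eq_lintegral_ofReal (f := fun s : ℝ => s)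
      ((continuous_id.integrableOn_Icc (a := (0 : ℝ)) (b := 1)).mono_set Ioo_subset_Icc_self)
      ((ae_restrict_iff' measurableSet_Ioo).2 (Eventually.of_forall fun s hs => hs.1.le)),
      ← integral_Ioc_eq_integral_Ioo, ← intervalIntegral.integral_of_le zero_le_one]
    simp
  have e2 : ∫⁻ ψ in Ioo ψ₂ ψ₁, ENNReal.ofReal (x ψ * y' ψ - (y ψ - c) * x' ψ)
      = ENNReal.ofReal (∫ ψ in ψ₂..ψ₁, (x ψ * y' ψ - (y ψ - c) * x' ψ)) := by
    rw [← ofReal_integral_eq_lintegral_ofReal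
      (hcont.integrableOn_Icc.mono_set Ioo_subset_Icc_self)
      ((ae_restrict_iff' measurableSet_Ioo).2 (Eventually.of_forall fun s hs => (hdet s hs).le)),
      ← integral_Ioc_eq_integral_Ioo, ← intervalIntegral.integral_of_le hlt.le]
  rw [e1, e2, ← ENNReal.ofReal_mul (by norm_num)]

end StarShaped

open Real

/-! ### Convex arcs with prescribed contact angles in a wedge -/

/-- The angles of a drop in a wedge: the wall angles `θ₁`, `θ₂` and the slope angles `ψ₁`, `ψ₂` of
the arc at the left and the right wall. The arc meets both walls under the same angle
`θ₁ + ψ₁ = θ₂ - ψ₂`. -/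
structure Wedge where
  (θ₁ θ₂ ψ₁ ψ₂ : ℝ)
  θ₁_pos : 0 < θ₁
  θ₂_pos : 0 < θ₂
  add_lt_pi : θ₁ + θ₂ < π
  ψ₁_pos : 0 < ψ₁
  ψ₂_neg : ψ₂ < 0
  contact_eq : θ₂ - ψ₂ = θ₁ + ψ₁
  contact_le_pi : θ₁ + ψ₁ ≤ π

/-- An admissible radius of curvature as a function of the slope angle: continuous, positive, and
the larger, the closer the slope is to horizontal, which is expressed by monotonicity in the cosine
of the slope angle. In particular it is even. -/
structure IsProfile (lam : ℝ → ℝ) : Prop where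
  cont : Continuous lam
  pos : ∀ ψ, 0 < lam ψ
  mono : ∀ ψ φ, cos ψ ≤ cos φ → lam ψ ≤ lam φ

theorem IsProfile.neg {lam : ℝ → ℝ} (h : IsProfile lam) (ψ : ℝ) : lam (-ψ) = lam ψ :=
  le_antisymm (h.mono _ _ (by rw [cos_neg])) (h.mono _ _ (by rw [cos_neg]))

namespace Wedge

variable (W : Wedge) {lam : ℝ → ℝ}

/-- The reflection of a wedge in the vertical axis. -/
def mirror : Wedge where
  θ₁ := W.θ₂
  θ₂ := W.θ₁
  ψ₁ := -W.ψ₂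
  ψ₂ := -W.ψ₁
  θ₁_pos := W.θ₂_pos
  θ₂_pos := W.θ₁_pos
  add_lt_pi := by linarith [W.add_lt_pi]
  ψ₁_pos := by linarith [W.ψ₂_neg]
  ψ₂_neg := by linarith [W.ψ₁_pos]
  contact_eq := by linarith [W.contact_eq]
  contact_le_pi := by linarith [W.contact_eq, W.contact_le_pi]

theorem ψ₂_lt_ψ₁ : W.ψ₂ < W.ψ₁ := W.ψ₂_neg.trans W.ψ₁_pos

theorem sin_add_pos : 0 < sin (W.θ₁ + W.θ₂) :=
  sin_pos_of_pos_of_lt_pi (add_pos W.θ₁_pos W.θ₂_pos) W.add_lt_pi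

/-- The distance from the corner to the contact point on the left wall, for the arc with radius of
curvature `lam`. It is obtained by projecting the arc along the right wall. -/
noncomputable def reach (lam : ℝ → ℝ) : ℝ :=
  (∫ φ in W.ψ₂..W.ψ₁, lam φ * sin (W.θ₂ - φ)) / sin (W.θ₁ + W.θ₂)

/-- The abscissa, relative to the corner, of the arc with radius of curvature `lam` that starts on
the left wall at distance `W.reach lam` from the corner. -/
noncomputable def arcX (lam : ℝ → ℝ) (ψ : ℝ) : ℝ :=
  -(W.reach lam * cos W.θ₁) + ∫ φ in ψ..W.ψ₁, lam φ * cos φ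

/-- The ordinate, relative to the corner, of the arc with radius of curvature `lam` that starts on
the left wall at distance `W.reach lam` from the corner. -/
noncomputable def arcY (lam : ℝ → ℝ) (ψ : ℝ) : ℝ :=
  W.reach lam * sin W.θ₁ + ∫ φ in ψ..W.ψ₁, lam φ * sin φ

/-- The support function of the arc: the distance from the corner to its tangent line with slope
angle `ψ`. -/
noncomputable def arcSupport (lam : ℝ → ℝ) (ψ : ℝ) : ℝ :=
  W.arcY lam ψ * cos ψ - W.arcX lam ψ * sin ψ

/-- The area between the arc with radius of curvature `lam` and the two walls. -/
noncomputable def arcArea (lam : ℝ → ℝ) : ℝ :=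
  1 / 2 * ∫ ψ in W.ψ₂..W.ψ₁, lam ψ * W.arcSupport lam ψ

theorem mirror_reach (hl : IsProfile lam) :
    W.mirror.reach lam
      = (∫ φ in W.ψ₂..W.ψ₁, lam φ * sin (W.θ₁ + φ)) / sin (W.θ₁ + W.θ₂) := by
  have h := intervalIntegral.integral_comp_neg (a := W.ψ₂) (b := W.ψ₁)
    (fun φ => lam φ * sin (W.θ₁ - φ))
  simp only [hl.neg, sub_neg_eq_add] at h
  simp only [reach, mirror, h, add_comm W.θ₂ W.θ₁]

/-- The two reaches are the solution of the linear system that closes the contour. -/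
theorem reach_closes (hl : IsProfile lam) :
    W.reach lam * cos W.θ₁ + W.mirror.reach lam * cos W.θ₂
        = ∫ φ in W.ψ₂..W.ψ₁, lam φ * cos φ ∧
      W.mirror.reach lam * sin W.θ₂ - W.reach lam * sin W.θ₁
        = ∫ φ in W.ψ₂..W.ψ₁, lam φ * sin φ := by
  have hc := hl.cont
  have e1 : ∫ φ in W.ψ₂..W.ψ₁, lam φ * sin (W.θ₂ - φ)
      = sin W.θ₂ * (∫ φ in W.ψ₂..W.ψ₁, lam φ * cos φ)
        - cos W.θ₂ * ∫ φ in W.ψ₂..W.ψ₁, lam φ * sin φ := by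
    rw [← intervalIntegral.integral_const_mul, ← intervalIntegral.integral_const_mul,
      ← intervalIntegral.integral_sub (Continuous.intervalIntegrable (by fun_prop) _ _)
        (Continuous.intervalIntegrable (by fun_prop) _ _)]
    refine intervalIntegral.integral_congr fun φ _ => ?_
    simp only [sin_sub]
    ring
  have e2 : ∫ φ in W.ψ₂..W.ψ₁, lam φ * sin (W.θ₁ + φ)
      = sin W.θ₁ * (∫ φ in W.ψ₂..W.ψ₁, lam φ * cos φ)
        + cos W.θ₁ * ∫ φ in W.ψ₂..W.ψ₁, lam φ * sin φ := by
    rw [← intervalIntegral.integral_const_mul, ← intervalIntegral.integral_const_mul,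
      ← intervalIntegral.integral_add (Continuous.intervalIntegrable (by fun_prop) _ _)
        (Continuous.intervalIntegrable (by fun_prop) _ _)]
    refine intervalIntegral.integral_congr fun φ _ => ?_
    simp only [sin_add]
    ring
  have hS := W.sin_add_pos.ne'
  rw [W.mirror_reach hl, reach, e1, e2]
  constructor
  · field_simp
    rw [sin_add]
    ring
  · field_simp
    rw [sin_add]
    ring

theorem arcX_left : W.arcX lam W.ψ₁ = -(W.reach lam * cos W.θ₁) := by simp [arcX]

theorem arcY_left : W.arcY lam W.ψ₁ = W.reach lam * sin W.θ₁ := by simp [arcY]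

theorem mirror_arcX (hl : IsProfile lam) (ψ : ℝ) :
    W.mirror.arcX lam (-ψ) = -W.arcX lam ψ := by
  have hc := hl.cont
  have h := intervalIntegral.integral_comp_neg (a := W.ψ₂) (b := ψ) (fun φ => lam φ * cos φ)
  simp only [hl.neg, cos_neg] at h
  have h2 := intervalIntegral.integral_add_adjacent_intervals (μ := volume)
    (f := fun φ => lam φ * cos φ) (a := W.ψ₂) (b := ψ) (c := W.ψ₁)
    (Continuous.intervalIntegrable (by fun_prop) _ _)
    (Continuous.intervalIntegrable (by fun_prop) _ _)
  have h3 := (W.reach_closes hl).1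
  unfold arcX
  simp only [mirror] at h3 ⊢
  linarith

theorem mirror_arcY (hl : IsProfile lam) (ψ : ℝ) :
    W.mirror.arcY lam (-ψ) = W.arcY lam ψ := by
  have hc := hl.cont
  have h := intervalIntegral.integral_comp_neg (a := W.ψ₂) (b := ψ) (fun φ => lam φ * sin φ)
  simp only [hl.neg, sin_neg, mul_neg, intervalIntegral.integral_neg] at h
  have h2 := intervalIntegral.integral_add_adjacent_intervals (μ := volume)
    (f := fun φ => lam φ * sin φ) (a := W.ψ₂) (b := ψ) (c := W.ψ₁)
    (Continuous.intervalIntegrable (by fun_prop) _ _)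
    (Continuous.intervalIntegrable (by fun_prop) _ _)
  have h3 := (W.reach_closes hl).2
  unfold arcY
  simp only [mirror] at h3 ⊢
  linarith

theorem arcX_right (hl : IsProfile lam) : W.arcX lam W.ψ₂ = W.mirror.reach lam * cos W.θ₂ := by
  have h := W.mirror_arcX hl W.ψ₂
  have h2 : W.mirror.arcX lam (-W.ψ₂) = _ := W.mirror.arcX_left
  have h3 : W.mirror.θ₁ = W.θ₂ := rfl
  rw [h3] at h2
  linarith

theorem arcY_right (hl : IsProfile lam) : W.arcY lam W.ψ₂ = W.mirror.reach lam * sin W.θ₂ := by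
  have h := W.mirror_arcY hl W.ψ₂
  have h2 : W.mirror.arcY lam (-W.ψ₂) = _ := W.mirror.arcY_left
  have h3 : W.mirror.θ₁ = W.θ₂ := rfl
  rw [h3] at h2
  linarith

theorem mirror_arcSupport (hl : IsProfile lam) (ψ : ℝ) :
    W.mirror.arcSupport lam (-ψ) = W.arcSupport lam ψ := by
  simp only [arcSupport, W.mirror_arcX hl, W.mirror_arcY hl, cos_neg, sin_neg]
  ring

theorem hasDerivAt_arcX (hl : Continuous lam) (ψ : ℝ) :
    HasDerivAt (W.arcX lam) (-(lam ψ * cos ψ)) ψ := by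
  have hc : Continuous fun φ => lam φ * cos φ := by fun_prop
  exact (intervalIntegral.integral_hasDerivAt_left (hc.intervalIntegrable _ _)
    (hc.stronglyMeasurableAtFilter _ _) hc.continuousAt).const_add _

theorem hasDerivAt_arcY (hl : Continuous lam) (ψ : ℝ) :
    HasDerivAt (W.arcY lam) (-(lam ψ * sin ψ)) ψ := by
  have hc : Continuous fun φ => lam φ * sin φ := by fun_prop
  exact (intervalIntegral.integral_hasDerivAt_left (hc.intervalIntegrable _ _)
    (hc.stronglyMeasurableAtFilter _ _) hc.continuousAt).const_add _

theorem continuous_arcX (hl : Continuous lam) : Continuous (W.arcX lam) :=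
  continuous_iff_continuousAt.2 fun ψ => (W.hasDerivAt_arcX hl ψ).continuousAt

theorem continuous_arcY (hl : Continuous lam) : Continuous (W.arcY lam) :=
  continuous_iff_continuousAt.2 fun ψ => (W.hasDerivAt_arcY hl ψ).continuousAt

theorem continuous_arcSupport (hl : Continuous lam) : Continuous (W.arcSupport lam) :=
  ((W.continuous_arcY hl).mul continuous_cos).sub ((W.continuous_arcX hl).mul continuous_sin)

/-- A lower bound for the reach, uniform in the profile. Where the integrand `lam φ * sin (θ₂ - φ)`
is negative, namely for `φ > θ₂`, it is outweighed by its value at the reflected angle `2 θ₂ - φ`,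
which is closer to the horizontal; the part of the interval without a partner remains. -/
theorem exists_le_reach : ∃ m > 0, ∀ lam, IsProfile lam → ∀ l, 0 ≤ l → (∀ ψ, l ≤ lam ψ) →
    l * m ≤ W.reach lam := by
  have hS := W.sin_add_pos
  have hθ₁ := W.θ₁_pos
  have hθ₂ := W.θ₂_pos
  have hψ₁ := W.ψ₁_pos
  have hψ₂ := W.ψ₂_neg
  have hceq := W.contact_eq
  have hcle := W.contact_le_pi
  set e := min W.ψ₁ (2 * W.θ₂ - W.ψ₁) with he
  have he1 : e ≤ W.ψ₁ := min_le_left _ _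
  have he2 : e ≤ 2 * W.θ₂ - W.ψ₁ := min_le_right _ _
  have hlt : W.ψ₂ < e := lt_min W.ψ₂_lt_ψ₁ (by linarith)
  have heθ : e ≤ W.θ₂ := by linarith
  have hsin : ∀ φ ∈ Icc W.ψ₂ e, 0 ≤ sin (W.θ₂ - φ) := fun φ hφ =>
    sin_nonneg_of_nonneg_of_le_pi (by linarith [hφ.2]) (by linarith [hφ.1])
  have hm : 0 < ∫ φ in W.ψ₂..e, sin (W.θ₂ - φ) := by
    refine intervalIntegral.intervalIntegral_pos_of_pos_on
      (Continuous.intervalIntegrable (by fun_prop) _ _) (fun φ hφ => ?_) hlt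
    exact sin_pos_of_pos_of_lt_pi (by linarith [hφ.2]) (by linarith [hφ.1])
  refine ⟨(∫ φ in W.ψ₂..e, sin (W.θ₂ - φ)) / sin (W.θ₁ + W.θ₂), div_pos hm hS, ?_⟩
  intro lam hl l hl0 hle
  have hc := hl.cont
  have hi : ∀ a b, IntervalIntegrable (fun φ => lam φ * sin (W.θ₂ - φ)) volume a b := fun a b =>
    Continuous.intervalIntegrable (by fun_prop) _ _
  rw [← mul_div_assoc, reach]
  refine div_le_div_of_nonneg_right ?_ hS.le
  have hpart : l * (∫ φ in W.ψ₂..e, sin (W.θ₂ - φ))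
      ≤ ∫ φ in W.ψ₂..e, lam φ * sin (W.θ₂ - φ) := by
    rw [← intervalIntegral.integral_const_mul]
    refine intervalIntegral.integral_mono_on hlt.le
      (Continuous.intervalIntegrable (by fun_prop) _ _) (hi _ _) fun φ hφ => ?_
    exact mul_le_mul_of_nonneg_right (hle φ) (hsin φ hφ)
  refine hpart.trans ?_
  rw [← intervalIntegral.integral_add_adjacent_intervals (hi W.ψ₂ e) (hi e W.ψ₁)]
  refine le_add_of_nonneg_right ?_
  rcases le_total W.ψ₁ W.θ₂ with hcase | hcase
  · rw [show e = W.ψ₁ from min_eq_left (by linarith)]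
    simp
  · have he' : e = 2 * W.θ₂ - W.ψ₁ := min_eq_right (by linarith)
    rw [he', ← intervalIntegral.integral_add_adjacent_intervals (hi _ W.θ₂) (hi _ _)]
    have hrefl := intervalIntegral.integral_comp_sub_left (a := 2 * W.θ₂ - W.ψ₁) (b := W.θ₂)
      (fun φ => lam φ * sin (W.θ₂ - φ)) (2 * W.θ₂)
    rw [show 2 * W.θ₂ - W.θ₂ = W.θ₂ by ring,
      show 2 * W.θ₂ - (2 * W.θ₂ - W.ψ₁) = W.ψ₁ by ring] at hrefl
    rw [← hrefl, ← intervalIntegral.integral_add (hi _ _)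
      (Continuous.intervalIntegrable (by fun_prop) _ _)]
    refine intervalIntegral.integral_nonneg (by linarith) fun φ hφ => ?_
    have hcos : cos (2 * W.θ₂ - φ) ≤ cos φ := by
      rw [← cos_abs φ]
      exact cos_le_cos_of_nonneg_of_le_pi (abs_nonneg φ) (by linarith [hφ.1])
        (abs_le.2 ⟨by linarith [hφ.2], by linarith [hφ.2]⟩)
    have h1 := hl.mono _ _ hcos
    have h2 : 0 ≤ sin (W.θ₂ - φ) :=
      sin_nonneg_of_nonneg_of_le_pi (by linarith [hφ.2]) (by linarith [hφ.1])
    have h3 : sin (W.θ₂ - (2 * W.θ₂ - φ)) = -sin (W.θ₂ - φ) := by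
      rw [← sin_neg]; congr 1; ring
    rw [h3]
    nlinarith

theorem reach_pos (hl : IsProfile lam) : 0 < W.reach lam := by
  obtain ⟨m, hm, h⟩ := W.exists_le_reach
  have := h lam hl (lam π) (hl.pos π).le fun ψ =>
    hl.mono _ _ (by rw [cos_pi]; exact neg_one_le_cos ψ)
  exact (mul_pos (hl.pos π) hm).trans_le this

theorem arcSupport_eq (hl : Continuous lam) (ψ : ℝ) :
    W.arcSupport lam ψ
      = W.reach lam * sin (W.θ₁ + ψ) + ∫ φ in ψ..W.ψ₁, lam φ * sin (φ - ψ) := by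
  have e1 : ∫ φ in ψ..W.ψ₁, lam φ * sin (φ - ψ)
      = cos ψ * (∫ φ in ψ..W.ψ₁, lam φ * sin φ)
        - sin ψ * ∫ φ in ψ..W.ψ₁, lam φ * cos φ := by
    rw [← intervalIntegral.integral_const_mul, ← intervalIntegral.integral_const_mul,
      ← intervalIntegral.integral_sub (Continuous.intervalIntegrable (by fun_prop) _ _)
        (Continuous.intervalIntegrable (by fun_prop) _ _)]
    refine intervalIntegral.integral_congr fun φ _ => ?_
    simp only [sin_sub]
    ring
  rw [e1, sin_add, arcSupport, arcX, arcY]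
  ring

theorem ψ₁_lt_pi : W.ψ₁ < π := by linarith [W.θ₁_pos, W.contact_le_pi]

theorem reach_mul_sin_le_arcSupport (hl : IsProfile lam) {ψ : ℝ} (h0 : 0 ≤ ψ) (h1 : ψ ≤ W.ψ₁) :
    W.reach lam * sin (W.θ₁ + ψ) ≤ W.arcSupport lam ψ := by
  rw [W.arcSupport_eq hl.cont]
  refine le_add_of_nonneg_right (intervalIntegral.integral_nonneg h1 fun φ hφ => ?_)
  exact mul_nonneg (hl.pos φ).le (sin_nonneg_of_nonneg_of_le_pi (by linarith [hφ.1])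
    (by linarith [hφ.2, W.ψ₁_lt_pi]))

theorem arcSupport_pos_of_nonneg (hl : IsProfile lam) {ψ : ℝ} (h0 : 0 ≤ ψ) (h1 : ψ < W.ψ₁) :
    0 < W.arcSupport lam ψ := by
  refine lt_of_lt_of_le (mul_pos (W.reach_pos hl) (sin_pos_of_pos_of_lt_pi ?_ ?_))
    (W.reach_mul_sin_le_arcSupport hl h0 h1.le)
  · linarith [W.θ₁_pos]
  · linarith [W.contact_le_pi]

/-- The corner lies strictly below every tangent line of the arc, end points excepted. This is seen
from the left contact point for `ψ ≥ 0` and from the right one for `ψ ≤ 0`. -/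
theorem arcSupport_pos (hl : IsProfile lam) {ψ : ℝ} (hψ : ψ ∈ Ioo W.ψ₂ W.ψ₁) :
    0 < W.arcSupport lam ψ := by
  rcases le_total 0 ψ with h | h
  · exact W.arcSupport_pos_of_nonneg hl h hψ.2
  · rw [← W.mirror_arcSupport hl]
    exact W.mirror.arcSupport_pos_of_nonneg hl (by linarith) (neg_lt_neg hψ.1)

/-- The arc lies strictly to the left of the line through the right wall: its distance from that
line increases up to `ψ = θ₂` and decreases afterwards to a positive value. -/
theorem arc_left_of_wall (hl : IsProfile lam) {ψ : ℝ} (hψ : ψ ∈ Ioc W.ψ₂ W.ψ₁) :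
    0 < cos W.θ₂ * W.arcY lam ψ - sin W.θ₂ * W.arcX lam ψ := by
  have hceq := W.contact_eq
  have hcle := W.contact_le_pi
  have hθ₁ := W.θ₁_pos
  have hθ₂ := W.θ₂_pos
  set A : ℝ → ℝ := fun ψ => cos W.θ₂ * W.arcY lam ψ - sin W.θ₂ * W.arcX lam ψ with hA
  have hd : ∀ ψ, HasDerivAt A (lam ψ * sin (W.θ₂ - ψ)) ψ := fun ψ => by
    refine (((W.hasDerivAt_arcY hl.cont ψ).const_mul (cos W.θ₂)).fun_sub
      ((W.hasDerivAt_arcX hl.cont ψ).const_mul (sin W.θ₂))).congr_deriv ?_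
    rw [sin_sub]
    ring
  have hAc : Continuous A := continuous_iff_continuousAt.2 fun ψ => (hd ψ).continuousAt
  have h₂ : A W.ψ₂ = 0 := by
    simp only [hA, W.arcX_right hl, W.arcY_right hl]
    ring
  have h₁ : 0 < A W.ψ₁ := by
    have : A W.ψ₁ = W.reach lam * sin (W.θ₁ + W.θ₂) := by
      simp only [hA, W.arcX_left, W.arcY_left, sin_add]
      ring
    rw [this]
    exact mul_pos (W.reach_pos hl) W.sin_add_pos
  change 0 < A ψ
  rcases le_total ψ W.θ₂ with h | h
  · have hmono : StrictMonoOn A (Icc W.ψ₂ ψ) := by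
      refine strictMonoOn_of_deriv_pos (convex_Icc _ _) hAc.continuousOn fun φ hφ => ?_
      rw [interior_Icc] at hφ
      rw [(hd φ).deriv]
      exact mul_pos (hl.pos φ)
        (sin_pos_of_pos_of_lt_pi (by linarith [hφ.2]) (by linarith [hφ.1]))
    rw [← h₂]
    exact hmono (left_mem_Icc.2 hψ.1.le) (right_mem_Icc.2 hψ.1.le) hψ.1
  · have hanti : AntitoneOn A (Icc ψ W.ψ₁) := by
      refine antitoneOn_of_deriv_nonpos (convex_Icc _ _) hAc.continuousOn
        (fun φ _ => (hd φ).differentiableAt.differentiableWithinAt) fun φ hφ => ?_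
      rw [interior_Icc] at hφ
      rw [(hd φ).deriv]
      exact mul_nonpos_of_nonneg_of_nonpos (hl.pos φ).le
        (sin_nonpos_of_nonpos_of_neg_pi_le (by linarith [hφ.1]) (by linarith [hφ.2]))
    exact h₁.trans_le (hanti (left_mem_Icc.2 hψ.2) (right_mem_Icc.2 hψ.2) hψ.2)

theorem arc_right_of_wall (hl : IsProfile lam) {ψ : ℝ} (hψ : ψ ∈ Ico W.ψ₂ W.ψ₁) :
    0 < cos W.θ₁ * W.arcY lam ψ + sin W.θ₁ * W.arcX lam ψ := by
  have h := W.mirror.arc_left_of_wall hl (ψ := -ψ) ⟨neg_lt_neg hψ.2, neg_le_neg hψ.1⟩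
  rw [W.mirror_arcX hl, W.mirror_arcY hl] at h
  simp only [mirror] at h
  linarith

/-- The arc turns strictly counterclockwise about the corner. In the oblique coordinates along the
two walls, which are positive on the arc, this says that their ratio is strictly monotone. -/
theorem arc_cross_pos (hl : IsProfile lam) {ψ φ : ℝ} (hψ : ψ ∈ Icc W.ψ₂ W.ψ₁)
    (hφ : φ ∈ Icc W.ψ₂ W.ψ₁) (h : ψ < φ) :
    0 < W.arcX lam ψ * W.arcY lam φ - W.arcY lam ψ * W.arcX lam φ := by
  have hS := W.sin_add_pos
  set A : ℝ → ℝ := fun ψ => cos W.θ₂ * W.arcY lam ψ - sin W.θ₂ * W.arcX lam ψ with hA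
  set B : ℝ → ℝ := fun ψ => cos W.θ₁ * W.arcY lam ψ + sin W.θ₁ * W.arcX lam ψ with hB
  have hdA : ∀ ψ, HasDerivAt A (lam ψ * sin (W.θ₂ - ψ)) ψ := fun ψ => by
    refine (((W.hasDerivAt_arcY hl.cont ψ).const_mul (cos W.θ₂)).fun_sub
      ((W.hasDerivAt_arcX hl.cont ψ).const_mul (sin W.θ₂))).congr_deriv ?_
    rw [sin_sub]
    ring
  have hdB : ∀ ψ, HasDerivAt B (-(lam ψ * sin (W.θ₁ + ψ))) ψ := fun ψ => by
    refine (((W.hasDerivAt_arcY hl.cont ψ).const_mul (cos W.θ₁)).fun_add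
      ((W.hasDerivAt_arcX hl.cont ψ).const_mul (sin W.θ₁))).congr_deriv ?_
    rw [sin_add]
    ring
  have hApos : ∀ ψ ∈ Ioc W.ψ₂ W.ψ₁, 0 < A ψ := fun ψ hψ => W.arc_left_of_wall hl hψ
  have hBpos : ∀ ψ ∈ Ico W.ψ₂ W.ψ₁, 0 < B ψ := fun ψ hψ => W.arc_right_of_wall hl hψ
  have hφ' : φ ∈ Ioc W.ψ₂ W.ψ₁ := ⟨hψ.1.trans_lt h, hφ.2⟩
  have key : A ψ * B φ < B ψ * A φ := by
    rcases eq_or_lt_of_le hψ.1 with h2 | h2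
    · have hA0 : A ψ = 0 := by
        simp only [hA, ← h2, W.arcX_right hl, W.arcY_right hl]
        ring
      rw [hA0, zero_mul]
      exact mul_pos (hBpos ψ ⟨hψ.1, h.trans_le hφ.2⟩) (hApos φ hφ')
    · have hanti : StrictAntiOn (fun ψ => B ψ / A ψ) (Ioc W.ψ₂ W.ψ₁) := by
        refine strictAntiOn_of_deriv_neg (convex_Ioc _ _) (fun ψ hψ =>
          ((hdB ψ).continuousAt.div (hdA ψ).continuousAt (hApos ψ hψ).ne').continuousWithinAt)
          fun ψ hψ => ?_
        rw [interior_Ioc] at hψ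
        have hA' := hApos ψ (Ioo_subset_Ioc_self hψ)
        rw [((hdB ψ).fun_div (hdA ψ) hA'.ne').deriv]
        refine div_neg_of_neg_of_pos ?_ (pow_pos hA' 2)
        have : -(lam ψ * sin (W.θ₁ + ψ)) * A ψ - B ψ * (lam ψ * sin (W.θ₂ - ψ))
            = -(lam ψ * sin (W.θ₁ + W.θ₂) * W.arcSupport lam ψ) := by
          simp only [hA, hB, arcSupport, sin_add, sin_sub]
          ring
        rw [this]
        exact neg_lt_zero.2 (mul_pos (mul_pos (hl.pos ψ) hS) (W.arcSupport_pos hl hψ))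
      have h3 := hanti ⟨h2, hψ.2⟩ hφ' h
      simp only at h3
      rw [div_lt_div_iff₀ (hApos φ hφ') (hApos ψ ⟨h2, hψ.2⟩)] at h3
      linarith
  have hid : sin (W.θ₁ + W.θ₂) * (W.arcX lam ψ * W.arcY lam φ - W.arcY lam ψ * W.arcX lam φ)
      = B ψ * A φ - A ψ * B φ := by
    simp only [hA, hB, sin_add]
    ring
  refine pos_of_mul_pos_right (a := sin (W.θ₁ + W.θ₂)) ?_ hS.le
  rw [hid]
  linarith

/-- The contour made of an arc and the two walls encloses the area `arcArea`. -/
theorem volume_fluidRegion_arc (hl : IsProfile lam) (c : ℝ) :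
    volume (fluidRegion W.ψ₁ W.ψ₂ c (W.arcX lam) fun ψ => c + W.arcY lam ψ)
      = ENNReal.ofReal (W.arcArea lam) := by
  have hc := hl.cont
  have hid : ∀ ψ, W.arcX lam ψ * -(lam ψ * sin ψ)
      - (c + W.arcY lam ψ - c) * -(lam ψ * cos ψ) = lam ψ * W.arcSupport lam ψ := fun ψ => by
    rw [arcSupport]
    ring
  rw [volume_fluidRegion_eq W.ψ₂_lt_ψ₁ (W.hasDerivAt_arcX hl.cont)
    (fun ψ => (W.hasDerivAt_arcY hl.cont ψ).const_add c) (by fun_prop) (by fun_prop)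
    (fun ψ hψ φ hφ h => ?_) (fun ψ hψ => ?_)]
  · simp only [hid, arcArea]
  · simp only [add_sub_cancel_left]
    exact W.arc_cross_pos hl hψ hφ h
  · rw [hid]
    exact mul_pos (hl.pos ψ) (W.arcSupport_pos hl hψ)

theorem arcArea_pos (hl : IsProfile lam) : 0 < W.arcArea lam := by
  refine mul_pos (by norm_num) (intervalIntegral.intervalIntegral_pos_of_pos_on
    ((hl.cont.mul (W.continuous_arcSupport hl.cont)).intervalIntegrable _ _)
    (fun ψ hψ => mul_pos (hl.pos ψ) (W.arcSupport_pos hl hψ)) W.ψ₂_lt_ψ₁)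

/-- The map from radii of curvature to support functions is symmetric. The difference of the two
integrals is the increment of the cross product of the two arcs, which vanishes at both ends
because the contact points of the two arcs lie on the same walls. -/
theorem integral_mul_arcSupport_comm {lam₁ lam₂ : ℝ → ℝ} (h₁ : IsProfile lam₁)
    (h₂ : IsProfile lam₂) :
    ∫ ψ in W.ψ₂..W.ψ₁, lam₁ ψ * W.arcSupport lam₂ ψ
      = ∫ ψ in W.ψ₂..W.ψ₁, lam₂ ψ * W.arcSupport lam₁ ψ := by
  have hc₁ := h₁.cont.fun_mul (W.continuous_arcSupport h₂.cont)
  have hc₂ := h₂.cont.fun_mul (W.continuous_arcSupport h₁.cont)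
  have hd : ∀ ψ, HasDerivAt
      (fun ψ => W.arcX lam₁ ψ * W.arcY lam₂ ψ - W.arcY lam₁ ψ * W.arcX lam₂ ψ)
      (lam₂ ψ * W.arcSupport lam₁ ψ - lam₁ ψ * W.arcSupport lam₂ ψ) ψ := fun ψ => by
    refine (((W.hasDerivAt_arcX h₁.cont ψ).fun_mul (W.hasDerivAt_arcY h₂.cont ψ)).fun_sub
      ((W.hasDerivAt_arcY h₁.cont ψ).fun_mul (W.hasDerivAt_arcX h₂.cont ψ))).congr_deriv ?_
    simp only [arcSupport]
    ring
  have h := intervalIntegral.integral_eq_sub_of_hasDerivAt (a := W.ψ₂) (b := W.ψ₁)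
    (fun ψ _ => hd ψ) ((hc₂.fun_sub hc₁).intervalIntegrable _ _)
  rw [intervalIntegral.integral_sub (hc₂.intervalIntegrable _ _) (hc₁.intervalIntegrable _ _)] at h
  simp only [W.arcX_left, W.arcY_left, W.arcX_right h₁, W.arcY_right h₁, W.arcX_right h₂,
    W.arcY_right h₂] at h
  linarith

/-- The area increases with the radius of curvature: it is a symmetric quadratic form in it, whose
differential at an admissible profile is the integral against the positive support function. -/
theorem arcArea_lt {lam₁ lam₂ : ℝ → ℝ} (h₁ : IsProfile lam₁) (h₂ : IsProfile lam₂)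
    (hlt : ∀ ψ, lam₁ ψ < lam₂ ψ) : W.arcArea lam₁ < W.arcArea lam₂ := by
  have hs₁ := W.continuous_arcSupport h₁.cont
  have hs₂ := W.continuous_arcSupport h₂.cont
  have hc₁ := h₁.cont
  have hc₂ := h₂.cont
  have hpos : 0 < ∫ ψ in W.ψ₂..W.ψ₁,
      (lam₂ ψ - lam₁ ψ) * (W.arcSupport lam₁ ψ + W.arcSupport lam₂ ψ) :=
    intervalIntegral.intervalIntegral_pos_of_pos_on
      (Continuous.intervalIntegrable (by fun_prop) _ _)
      (fun ψ hψ => mul_pos (sub_pos.2 (hlt ψ))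
        (add_pos (W.arcSupport_pos h₁ hψ) (W.arcSupport_pos h₂ hψ))) W.ψ₂_lt_ψ₁
  have hexp : ∫ ψ in W.ψ₂..W.ψ₁,
      (lam₂ ψ - lam₁ ψ) * (W.arcSupport lam₁ ψ + W.arcSupport lam₂ ψ)
      = ((∫ ψ in W.ψ₂..W.ψ₁, lam₂ ψ * W.arcSupport lam₂ ψ)
          - ∫ ψ in W.ψ₂..W.ψ₁, lam₁ ψ * W.arcSupport lam₁ ψ)
        + ((∫ ψ in W.ψ₂..W.ψ₁, lam₂ ψ * W.arcSupport lam₁ ψ)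
          - ∫ ψ in W.ψ₂..W.ψ₁, lam₁ ψ * W.arcSupport lam₂ ψ) := by
    rw [← intervalIntegral.integral_sub (Continuous.intervalIntegrable (by fun_prop) _ _)
        (Continuous.intervalIntegrable (by fun_prop) _ _),
      ← intervalIntegral.integral_sub (Continuous.intervalIntegrable (by fun_prop) _ _)
        (Continuous.intervalIntegrable (by fun_prop) _ _),
      ← intervalIntegral.integral_add (Continuous.intervalIntegrable (by fun_prop) _ _)
        (Continuous.intervalIntegrable (by fun_prop) _ _)]
    exact intervalIntegral.integral_congr fun ψ _ => by ring
  rw [hexp, W.integral_mul_arcSupport_comm h₁ h₂, sub_self, add_zero] at hpos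
  unfold arcArea
  linarith

end Wedge

/-! ### Integration of the free-surface equations -/

/-- The square of the height, as a function of the slope angle, of the free surface whose highest
point has height `u`. -/
noncomputable def heightSq (g σ u ψ : ℝ) : ℝ := u ^ 2 + 2 * (σ / g) * (1 - cos ψ)

/-- The radius of curvature of the free surface whose highest point has height `u`. -/
noncomputable def radius (g σ u ψ : ℝ) : ℝ := σ / (g * √(heightSq g σ u ψ))

section Profile

variable {g σ u : ℝ}

theorem sq_le_heightSq (hg : 0 < g) (hσ : 0 < σ) (ψ : ℝ) : u ^ 2 ≤ heightSq g σ u ψ :=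
  le_add_of_nonneg_right (mul_nonneg (by positivity) (sub_nonneg.2 (cos_le_one ψ)))

theorem heightSq_pos (hg : 0 < g) (hσ : 0 < σ) (hu : u < 0) (ψ : ℝ) : 0 < heightSq g σ u ψ :=
  (sq_pos_of_neg hu).trans_le (sq_le_heightSq hg hσ ψ)

theorem isProfile_radius (hg : 0 < g) (hσ : 0 < σ) (hu : u < 0) : IsProfile (radius g σ u) where
  cont := by
    have h : ∀ ψ, g * √(heightSq g σ u ψ) ≠ 0 := fun ψ =>
      (mul_pos hg (sqrt_pos.2 (heightSq_pos hg hσ hu ψ))).ne'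
    unfold radius
    refine continuous_const.div ?_ h
    unfold heightSq
    fun_prop
  pos ψ := div_pos hσ (mul_pos hg (sqrt_pos.2 (heightSq_pos hg hσ hu ψ)))
  mono ψ φ h := by
    have hφ := sqrt_pos.2 (heightSq_pos hg hσ hu φ)
    unfold radius
    refine div_le_div_of_nonneg_left hσ.le (mul_pos hg hφ) ?_
    refine mul_le_mul_of_nonneg_left (sqrt_le_sqrt ?_) hg.le
    unfold heightSq
    gcongr

theorem radius_lt_radius {v : ℝ} (hg : 0 < g) (hσ : 0 < σ) (huv : u < v) (hv : v < 0) (ψ : ℝ) :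
    radius g σ u ψ < radius g σ v ψ := by
  have hpos := heightSq_pos hg hσ hv ψ
  unfold radius
  refine div_lt_div_of_pos_left hσ (mul_pos hg (sqrt_pos.2 hpos)) ?_
  refine mul_lt_mul_of_pos_left (sqrt_lt_sqrt hpos.le ?_) hg
  unfold heightSq
  nlinarith

theorem hasDerivAt_neg_sqrt_heightSq (hg : 0 < g) (hσ : 0 < σ) (hu : u < 0) (ψ : ℝ) :
    HasDerivAt (fun ψ => -√(heightSq g σ u ψ)) (-(radius g σ u ψ * sin ψ)) ψ := by
  have hpos := heightSq_pos hg hσ hu ψ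
  have h1 : HasDerivAt (heightSq g σ u) (2 * (σ / g) * sin ψ) ψ := by
    have := (((hasDerivAt_cos ψ).const_sub 1).const_mul (2 * (σ / g))).const_add (u ^ 2)
    rwa [neg_neg] at this
  refine (h1.sqrt hpos.ne').fun_neg.congr_deriv ?_
  have := (sqrt_pos.2 hpos).ne'
  unfold radius
  field_simp

end Profile

theorem eq_of_hasDerivWithinAt_zero {f : ℝ → ℝ} {a b : ℝ}
    (hf : ∀ t ∈ Icc a b, HasDerivWithinAt f 0 (Icc a b) t) {s t : ℝ} (hs : s ∈ Icc a b)
    (ht : t ∈ Icc a b) : f t = f s := by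
  have h := (convex_Icc a b).norm_image_sub_le_of_norm_hasDerivWithin_le (f' := fun _ => 0)
    (C := 0) hf (by simp) hs ht
  rw [zero_mul, norm_le_zero_iff, sub_eq_zero] at h
  exact h

/-- Along a free surface `g y² / 2 + σ cos ψ` is constant. -/
theorem SolvesSurfaceODE.sq_eq {g σ ψ₁ ψ₂ : ℝ} {x y : ℝ → ℝ} (hg : 0 < g)
    (h : SolvesSurfaceODE g σ 0 ψ₁ ψ₂ x y) (h0 : (0 : ℝ) ∈ Icc ψ₂ ψ₁) {ψ : ℝ}
    (hψ : ψ ∈ Icc ψ₂ ψ₁) : y ψ ^ 2 = heightSq g σ (y 0) ψ := by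
  have hE : ∀ t ∈ Icc ψ₂ ψ₁,
      HasDerivWithinAt (fun t => y t ^ 2 + 2 * (σ / g) * cos t) 0 (Icc ψ₂ ψ₁) t := by
    intro t ht
    obtain ⟨hne, -, hy⟩ := h t ht
    refine ((hy.fun_pow 2).fun_add
      ((hasDerivAt_cos t).hasDerivWithinAt.const_mul (2 * (σ / g)))).congr_deriv ?_
    rw [sub_zero] at hne
    have hy0 : y t ≠ 0 := right_ne_zero_of_mul hne
    simp only [sub_zero]
    field_simp
    ring
  have := eq_of_hasDerivWithinAt_zero hE h0 hψ
  rw [cos_zero] at this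
  unfold heightSq
  linarith

/-- A free surface that is highest at `ψ = 0` lies below height zero: at positive height it would be
lowest there. -/
theorem IsShiftedCurve.neg {g σ ψ₁ ψ₂ xm um : ℝ} {x y : ℝ → ℝ} (hg : 0 < g) (hσ : 0 < σ)
    (hψ₁ : 0 < ψ₁) (hπ : ψ₁ < π) (hψ₂ : ψ₂ ≤ 0)
    (h : IsShiftedCurve g σ ψ₁ ψ₂ xm um x y) : um < 0 := by
  have h0 : (0 : ℝ) ∈ Icc ψ₂ ψ₁ := ⟨hψ₂, hψ₁.le⟩
  have h1 : ψ₁ ∈ Icc ψ₂ ψ₁ := right_mem_Icc.2 (hψ₂.trans hψ₁.le)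
  by_contra! hum
  have hle : y ψ₁ ≤ um := h.isLUB.1 (mem_image_of_mem y h1)
  have hyc : ContinuousOn y (Icc 0 ψ₁) := fun t ht =>
    ((h.ode t ⟨hψ₂.trans ht.1, ht.2⟩).2.2.continuousWithinAt).mono (Icc_subset_Icc_left hψ₂)
  have hpos : 0 < y ψ₁ := by
    by_contra! hneg
    obtain ⟨t, ht, hyt⟩ := intermediate_value_Icc' hψ₁.le hyc ⟨hneg, by rwa [h.y_zero]⟩
    exact (h.ode t ⟨hψ₂.trans ht.1, ht.2⟩).1 (by simp [hyt])
  have hsq := h.ode.sq_eq hg h0 h1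
  rw [h.y_zero, heightSq] at hsq
  have hcos : cos ψ₁ < 1 := by
    rw [← cos_zero]
    exact cos_lt_cos_of_nonneg_of_le_pi le_rfl hπ.le hψ₁
  have : 0 < 2 * (σ / g) * (1 - cos ψ₁) := mul_pos (by positivity) (sub_pos.2 hcos)
  nlinarith

namespace Wedge

variable (W : Wedge) {g σ xm um : ℝ} {x y : ℝ → ℝ}

theorem zero_mem : (0 : ℝ) ∈ Icc W.ψ₂ W.ψ₁ := ⟨W.ψ₂_neg.le, W.ψ₁_pos.le⟩

/-- The height of the free surface differs from the ordinate of the arc by a constant. -/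
theorem arcY_radius (hg : 0 < g) (hσ : 0 < σ) (hu : um < 0) (ψ : ℝ) :
    um - W.arcY (radius g σ um) 0 + W.arcY (radius g σ um) ψ = -√(heightSq g σ um ψ) := by
  have hd : ∀ t, HasDerivAt (fun t => W.arcY (radius g σ um) t - -√(heightSq g σ um t)) 0 t :=
    fun t => ((W.hasDerivAt_arcY (isProfile_radius hg hσ hu).cont t).fun_sub
      (hasDerivAt_neg_sqrt_heightSq hg hσ hu t)).congr_deriv (sub_self _)
  have h := is_const_of_deriv_eq_zero (fun t => (hd t).differentiableAt)
    (fun t => (hd t).deriv) ψ 0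
  have h0 : √(heightSq g σ um 0) = -um := by
    simp only [heightSq, cos_zero, sub_self, mul_zero, add_zero, sqrt_sq_eq_abs, abs_of_neg hu]
  simp only [h0] at h
  linarith

theorem isShiftedCurve_arc (hg : 0 < g) (hσ : 0 < σ) (hu : um < 0) :
    IsShiftedCurve g σ W.ψ₁ W.ψ₂ xm um
      (fun ψ => xm - W.arcX (radius g σ um) 0 + W.arcX (radius g σ um) ψ)
      (fun ψ => um - W.arcY (radius g σ um) 0 + W.arcY (radius g σ um) ψ) where
  ode ψ _ := by
    have hpos := sqrt_pos.2 (heightSq_pos hg hσ hu ψ)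
    have hc := (isProfile_radius hg hσ hu).cont
    simp only [W.arcY_radius hg hσ hu, sub_zero]
    refine ⟨mul_ne_zero hg.ne' (neg_ne_zero.2 hpos.ne'), ?_, ?_⟩
    · refine (((W.hasDerivAt_arcX hc ψ).const_add _).congr_deriv ?_).hasDerivWithinAt
      unfold radius
      field_simp
    · refine ((hasDerivAt_neg_sqrt_heightSq hg hσ hu ψ).congr_deriv ?_).hasDerivWithinAt
      unfold radius
      field_simp
  x_zero := by ring
  y_zero := by ring
  isLUB := by
    refine IsGreatest.isLUB ⟨⟨0, W.zero_mem, by ring⟩, ?_⟩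
    rintro _ ⟨ψ, -, rfl⟩
    simp only [W.arcY_radius hg hσ hu]
    rw [neg_le]
    exact le_sqrt_of_sq_le (by rw [neg_sq]; exact sq_le_heightSq hg hσ ψ)

/-- Every free surface is a translate of an arc. -/
theorem eq_arc_of_isShiftedCurve (hg : 0 < g) (hσ : 0 < σ)
    (h : IsShiftedCurve g σ W.ψ₁ W.ψ₂ xm um x y) {ψ : ℝ} (hψ : ψ ∈ Icc W.ψ₂ W.ψ₁) :
    x ψ = xm - W.arcX (radius g σ um) 0 + W.arcX (radius g σ um) ψ ∧
      y ψ = um - W.arcY (radius g σ um) 0 + W.arcY (radius g σ um) ψ := by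
  have hu : um < 0 := h.neg hg hσ W.ψ₁_pos W.ψ₁_lt_pi W.ψ₂_neg.le
  have hc := (isProfile_radius hg hσ hu).cont
  have hy : ∀ t ∈ Icc W.ψ₂ W.ψ₁, y t = -√(heightSq g σ um t) := by
    intro t ht
    have hyt : y t ≤ 0 := (h.isLUB.1 (mem_image_of_mem y ht)).trans hu.le
    have hsq := h.ode.sq_eq hg W.zero_mem ht
    rw [h.y_zero] at hsq
    rw [← hsq, sqrt_sq_eq_abs, abs_of_nonpos hyt, neg_neg]
  refine ⟨?_, by rw [W.arcY_radius hg hσ hu, hy ψ hψ]⟩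
  have hd : ∀ t ∈ Icc W.ψ₂ W.ψ₁,
      HasDerivWithinAt (fun t => x t - W.arcX (radius g σ um) t) 0 (Icc W.ψ₂ W.ψ₁) t := by
    intro t ht
    refine ((h.ode t ht).2.1.fun_sub (W.hasDerivAt_arcX hc t).hasDerivWithinAt).congr_deriv ?_
    have hpos := sqrt_pos.2 (heightSq_pos hg hσ hu t)
    rw [hy t ht, radius, sub_zero]
    field_simp
    ring
  have := eq_of_hasDerivWithinAt_zero hd W.zero_mem hψ
  rw [h.x_zero] at this
  linarith

/-- The abscissa of the highest point of the free surface that fits into the wedge. -/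
noncomputable def apexX (g σ um : ℝ) : ℝ := W.arcX (radius g σ um) 0

/-- The pressure constant `-g c`, where `c` is the height of the corner of the wedge into which the
free surface fits. -/
noncomputable def pressure (g σ um : ℝ) : ℝ := -(g * (um - W.arcY (radius g σ um) 0))

/-- A translate of the arc has its end points on the walls only if the translation is trivial. -/
theorem meetsWalls_iff (hg : 0 < g) (hσ : 0 < σ)
    (h : IsShiftedCurve g σ W.ψ₁ W.ψ₂ xm um x y) (P : ℝ) :
    MeetsWalls W.θ₁ W.θ₂ W.ψ₁ W.ψ₂ (-P / g) x y
      ↔ xm = W.apexX g σ um ∧ P = W.pressure g σ um := by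
  have hl := isProfile_radius hg hσ (h.neg hg hσ W.ψ₁_pos W.ψ₁_lt_pi W.ψ₂_neg.le)
  obtain ⟨hx₁, hy₁⟩ := W.eq_arc_of_isShiftedCurve hg hσ h (right_mem_Icc.2 W.ψ₂_lt_ψ₁.le)
  obtain ⟨hx₂, hy₂⟩ := W.eq_arc_of_isShiftedCurve hg hσ h (left_mem_Icc.2 W.ψ₂_lt_ψ₁.le)
  rw [W.arcX_left] at hx₁
  rw [W.arcY_left] at hy₁
  rw [W.arcX_right hl] at hx₂
  rw [W.arcY_right hl] at hy₂
  have hS := W.sin_add_pos.ne'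
  unfold MeetsWalls apexX pressure
  rw [hx₁, hy₁, hx₂, hy₂]
  constructor
  · rintro ⟨⟨s, -, h1, h2⟩, t, -, h3, h4⟩
    have ha : sin (W.θ₁ + W.θ₂) * (xm - W.arcX (radius g σ um) 0) = 0 := by
      rw [sin_add]
      linear_combination (sin W.θ₁ * cos W.θ₂) * h1 + (cos W.θ₁ * cos W.θ₂) * h2
        + (cos W.θ₁ * sin W.θ₂) * h3 - (cos W.θ₁ * cos W.θ₂) * h4
    have hb : sin (W.θ₁ + W.θ₂) * (um - W.arcY (radius g σ um) 0 - -P / g) = 0 := by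
      rw [sin_add]
      linear_combination (sin W.θ₁ * sin W.θ₂) * h1 + (cos W.θ₁ * sin W.θ₂) * h2
        - (sin W.θ₁ * sin W.θ₂) * h3 + (sin W.θ₁ * cos W.θ₂) * h4
    have ha' := (mul_eq_zero.1 ha).resolve_left hS
    have hb' := (mul_eq_zero.1 hb).resolve_left hS
    refine ⟨by linarith, ?_⟩
    field_simp at hb'
    linarith
  · rintro ⟨rfl, rfl⟩
    have hc : -(-(g * (um - W.arcY (radius g σ um) 0))) / g
        = um - W.arcY (radius g σ um) 0 := by
      field_simp
    rw [hc]
    exact ⟨⟨_, W.reach_pos hl, by ring, rfl⟩, _, W.mirror.reach_pos hl, by ring, rfl⟩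

/-- The volume below the free surface with highest point at height `um`, in the wedge. -/
noncomputable def volumeAt (g σ um : ℝ) : ℝ := W.arcArea (radius g σ um)

theorem volume_fluidRegion (hg : 0 < g) (hσ : 0 < σ)
    (h : IsShiftedCurve g σ W.ψ₁ W.ψ₂ xm um x y) {P : ℝ}
    (hm : MeetsWalls W.θ₁ W.θ₂ W.ψ₁ W.ψ₂ (-P / g) x y) :
    volume (fluidRegion W.ψ₁ W.ψ₂ (-P / g) x y) = ENNReal.ofReal (W.volumeAt g σ um) := by
  have hl := isProfile_radius hg hσ (h.neg hg hσ W.ψ₁_pos W.ψ₁_lt_pi W.ψ₂_neg.le)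
  obtain ⟨hX, hP⟩ := (W.meetsWalls_iff hg hσ h P).1 hm
  have hc : -P / g = um - W.arcY (radius g σ um) 0 := by
    rw [hP, pressure]
    field_simp
  have heq : ∀ ψ ∈ Icc W.ψ₂ W.ψ₁, (x ψ, y ψ)
      = (W.arcX (radius g σ um) ψ, -P / g + W.arcY (radius g σ um) ψ) := by
    intro ψ hψ
    obtain ⟨h1, h2⟩ := W.eq_arc_of_isShiftedCurve hg hσ h hψ
    rw [h1, h2, hX, apexX, hc]
    simp
  rw [volumeAt, ← W.volume_fluidRegion_arc hl (-P / g)]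
  unfold fluidRegion closedContour
  rw [image_congr heq, heq _ (right_mem_Icc.2 W.ψ₂_lt_ψ₁.le),
    heq _ (left_mem_Icc.2 W.ψ₂_lt_ψ₁.le)]

end Wedge

/-! ### Dependence of the volume on the height of the highest point -/

namespace Wedge

variable (W : Wedge) {g σ : ℝ}

theorem strictMonoOn_volumeAt (hg : 0 < g) (hσ : 0 < σ) :
    StrictMonoOn (W.volumeAt g σ) (Iio 0) := fun _ hu _ hv huv =>
  W.arcArea_lt (isProfile_radius hg hσ hu) (isProfile_radius hg hσ hv)
    (radius_lt_radius hg hσ huv hv)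

theorem continuous_arcArea {Z : Type*} [TopologicalSpace Z] {lam : Z → ℝ → ℝ}
    (h : Continuous (Function.uncurry lam)) : Continuous fun z => W.arcArea (lam z) := by
  have hreach : Continuous fun z => W.reach (lam z) := by
    refine Continuous.div_const ?_ _
    exact intervalIntegral.continuous_parametric_intervalIntegral_of_continuous
      (f := fun z φ => lam z φ * sin (W.θ₂ - φ))
      (h.mul (continuous_sin.comp (continuous_const.sub continuous_snd))) continuous_const
  have hprim : ∀ {f : ℝ → ℝ}, Continuous f →
      Continuous fun p : Z × ℝ => ∫ φ in p.2..W.ψ₁, lam p.1 φ * f φ := by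
    intro f hf
    simp only [fun p : Z × ℝ =>
      intervalIntegral.integral_symm (μ := volume) (f := fun φ => lam p.1 φ * f φ) W.ψ₁ p.2]
    exact (intervalIntegral.continuous_parametric_primitive_of_continuous
      (f := fun z φ => lam z φ * f φ) (h.mul (hf.comp continuous_snd))).neg
  have hX : Continuous fun p : Z × ℝ => W.arcX (lam p.1) p.2 :=
    ((hreach.comp continuous_fst).mul continuous_const).neg.add (hprim continuous_cos)
  have hY : Continuous fun p : Z × ℝ => W.arcY (lam p.1) p.2 :=
    ((hreach.comp continuous_fst).mul continuous_const).add (hprim continuous_sin)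
  have hs : Continuous fun p : Z × ℝ => W.arcSupport (lam p.1) p.2 :=
    (hY.mul (continuous_cos.comp continuous_snd)).sub
      (hX.mul (continuous_sin.comp continuous_snd))
  exact continuous_const.mul
    (intervalIntegral.continuous_parametric_intervalIntegral_of_continuous
      (f := fun z ψ => lam z ψ * W.arcSupport (lam z) ψ) (h.mul hs) continuous_const)

theorem continuousOn_volumeAt (hg : 0 < g) (hσ : 0 < σ) :
    ContinuousOn (W.volumeAt g σ) (Iio 0) := by
  rw [continuousOn_iff_continuous_domRestrict]
  refine W.continuous_arcArea (lam := fun u : Iio (0 : ℝ) => radius g σ u) ?_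
  refine continuous_const.div ?_ fun p =>
    (mul_pos hg (sqrt_pos.2 (heightSq_pos hg hσ p.1.2 p.2))).ne'
  unfold heightSq
  fun_prop

/-- The area is at most quadratic in the radius of curvature. -/
theorem arcArea_le {lam : ℝ → ℝ} (hl : IsProfile lam) {r : ℝ} (hr : ∀ ψ, lam ψ ≤ r) :
    W.arcArea lam
      ≤ 1 / 2 * (W.ψ₁ - W.ψ₂) ^ 2 * (1 / sin (W.θ₁ + W.θ₂) + 1) * r ^ 2 := by
  have hr0 : 0 < r := (hl.pos 0).trans_le (hr 0)
  have hS := W.sin_add_pos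
  have hlt := W.ψ₂_lt_ψ₁
  have hsin : ∀ φ t, ‖lam φ * sin t‖ ≤ r := fun φ t => by
    rw [norm_mul, norm_of_nonneg (hl.pos φ).le, norm_eq_abs]
    exact (mul_le_of_le_one_right (hl.pos φ).le (abs_sin_le_one t)).trans (hr φ)
  have hreach : W.reach lam ≤ r * (W.ψ₁ - W.ψ₂) / sin (W.θ₁ + W.θ₂) := by
    refine div_le_div_of_nonneg_right ?_ hS.le
    refine (le_norm_self _).trans ((intervalIntegral.norm_integral_le_of_norm_le_const
      fun φ _ => hsin φ _).trans_eq ?_)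
    rw [abs_of_pos (sub_pos.2 hlt)]
  set M := r * (W.ψ₁ - W.ψ₂) / sin (W.θ₁ + W.θ₂) + r * (W.ψ₁ - W.ψ₂) with hM
  have hsupp : ∀ ψ ∈ Icc W.ψ₂ W.ψ₁, W.arcSupport lam ψ ≤ M := by
    intro ψ hψ
    rw [W.arcSupport_eq hl.cont]
    refine add_le_add ((mul_le_of_le_one_right (W.reach_pos hl).le (sin_le_one _)).trans hreach) ?_
    refine (le_norm_self _).trans ((intervalIntegral.norm_integral_le_of_norm_le_const
      fun φ _ => hsin φ _).trans ?_)
    rw [abs_of_nonneg (sub_nonneg.2 hψ.2)]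
    exact mul_le_mul_of_nonneg_left (by linarith [hψ.1]) hr0.le
  have hM0 : 0 ≤ M := by
    have : 0 < W.ψ₁ - W.ψ₂ := sub_pos.2 hlt
    positivity
  have hint : ∫ ψ in W.ψ₂..W.ψ₁, lam ψ * W.arcSupport lam ψ
      ≤ ∫ _ in W.ψ₂..W.ψ₁, r * M := by
    refine intervalIntegral.integral_mono_on hlt.le
      ((hl.cont.mul (W.continuous_arcSupport hl.cont)).intervalIntegrable _ _)
      (by simp) fun ψ hψ => ?_
    exact (mul_le_mul_of_nonneg_left (hsupp ψ hψ) (hl.pos ψ).le).trans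
      (mul_le_mul_of_nonneg_right (hr ψ) hM0)
  rw [intervalIntegral.integral_const, smul_eq_mul] at hint
  unfold arcArea
  calc 1 / 2 * ∫ ψ in W.ψ₂..W.ψ₁, lam ψ * W.arcSupport lam ψ
      ≤ 1 / 2 * ((W.ψ₁ - W.ψ₂) * (r * M)) := by gcongr
    _ = _ := by rw [hM]; ring

theorem tendsto_volumeAt_atBot (hg : 0 < g) (hσ : 0 < σ) :
    Tendsto (W.volumeAt g σ) atBot (𝓝 0) := by
  set K := 1 / 2 * (W.ψ₁ - W.ψ₂) ^ 2 * (1 / sin (W.θ₁ + W.θ₂) + 1) with hK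
  have hlim : Tendsto (fun u : ℝ => K * (σ / (g * -u)) ^ 2) atBot (𝓝 0) := by
    have h1 : Tendsto (fun u : ℝ => σ / (g * -u)) atBot (𝓝 0) :=
      tendsto_const_nhds.div_atTop (tendsto_neg_atBot_atTop.const_mul_atTop hg)
    simpa using (h1.pow 2).const_mul K
  refine tendsto_of_tendsto_of_tendsto_of_le_of_le' tendsto_const_nhds hlim ?_ ?_
  · filter_upwards [eventually_lt_atBot 0] with u hu
    exact (W.arcArea_pos (isProfile_radius hg hσ hu)).le
  · filter_upwards [eventually_lt_atBot 0] with u hu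
    refine W.arcArea_le (isProfile_radius hg hσ hu) fun ψ => ?_
    refine div_le_div_of_nonneg_left hσ.le (mul_pos hg (neg_pos.2 hu)) ?_
    refine mul_le_mul_of_nonneg_left (le_sqrt_of_sq_le ?_) hg.le
    rw [neg_sq]
    exact sq_le_heightSq hg hσ ψ

end Wedge

/-- The arc length from the highest point to the slope angle `δ` grows at least logarithmically. -/
theorem le_integral_radius {g σ u δ : ℝ} (hg : 0 < g) (hσ : 0 < σ) (hu : u < 0) (hδ : 0 < δ) :
    √(σ / g) * (log (√(σ / g) * δ) - log (-u)) ≤ ∫ ψ in 0..δ, radius g σ u ψ := by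
  have hk : 0 < √(σ / g) := sqrt_pos.2 (div_pos hσ hg)
  have hk2 : √(σ / g) ^ 2 = σ / g := sq_sqrt (div_pos hσ hg).le
  set k := √(σ / g) with hkdef
  have hl := isProfile_radius hg hσ hu
  have hden : ∀ ψ, 0 ≤ ψ → 0 < -u + k * ψ := fun ψ hψ =>
    add_pos_of_pos_of_nonneg (neg_pos.2 hu) (mul_nonneg hk.le hψ)
  have hd : ∀ ψ ∈ uIcc 0 δ,
      HasDerivAt (fun ψ => k * log (-u + k * ψ)) (k * (k / (-u + k * ψ))) ψ := by
    intro ψ hψ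
    rw [uIcc_of_le hδ.le] at hψ
    have h1 : HasDerivAt (fun ψ => -u + k * ψ) k ψ := by
      simpa using ((hasDerivAt_id ψ).const_mul k).const_add (-u)
    exact (h1.log (hden ψ hψ.1).ne').const_mul k
  have hint : IntervalIntegrable (fun ψ => k * (k / (-u + k * ψ))) volume 0 δ := by
    refine ContinuousOn.intervalIntegrable fun ψ hψ => ?_
    rw [uIcc_of_le hδ.le] at hψ
    have := (hden ψ hψ.1).ne'
    exact ContinuousAt.continuousWithinAt (by fun_prop (disch := assumption))
  have hFTC := intervalIntegral.integral_eq_sub_of_hasDerivAt hd hint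
  have hmono : ∫ ψ in 0..δ, k * (k / (-u + k * ψ)) ≤ ∫ ψ in 0..δ, radius g σ u ψ := by
    refine intervalIntegral.integral_mono_on hδ.le hint (hl.cont.intervalIntegrable _ _)
      fun ψ hψ => ?_
    have hpos := heightSq_pos hg hσ hu ψ
    have hsqrt : √(heightSq g σ u ψ) ≤ -u + k * ψ := by
      refine sqrt_le_iff.2 ⟨(hden ψ hψ.1).le, ?_⟩
      have h1 : 2 * (σ / g) * (1 - cos ψ) ≤ (k * ψ) ^ 2 := by
        rw [mul_pow, hk2]
        have := mul_le_mul_of_nonneg_left (one_sub_sq_div_two_le_cos (x := ψ))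
          (div_pos hσ hg).le
        linarith
      have h2 : 0 ≤ -u * (k * ψ) :=
        mul_nonneg (neg_pos.2 hu).le (mul_nonneg hk.le hψ.1)
      unfold heightSq
      nlinarith
    calc k * (k / (-u + k * ψ)) = (σ / g) / (-u + k * ψ) := by rw [← hk2]; ring
      _ ≤ (σ / g) / √(heightSq g σ u ψ) :=
        div_le_div_of_nonneg_left (div_pos hσ hg).le (sqrt_pos.2 hpos) hsqrt
      _ = radius g σ u ψ := by rw [radius, div_div]
  refine le_trans ?_ hmono
  rw [hFTC, mul_zero, add_zero, mul_sub]
  have : log (k * δ) ≤ log (-u + k * δ) := log_le_log (mul_pos hk hδ) (by linarith)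
  gcongr

namespace Wedge

variable (W : Wedge) {g σ : ℝ}

theorem tendsto_volumeAt_nhdsLT_zero (hg : 0 < g) (hσ : 0 < σ) :
    Tendsto (W.volumeAt g σ) (𝓝[<] 0) atTop := by
  obtain ⟨m, hm, hreach⟩ := W.exists_le_reach
  set δ := W.ψ₁ / 2 with hδdef
  have hδ : 0 < δ := half_pos W.ψ₁_pos
  have hδ₁ : δ < W.ψ₁ := half_lt_self W.ψ₁_pos
  obtain ⟨t, ht, htmin⟩ := isCompact_Icc.exists_isMinOn (nonempty_Icc.2 hδ.le)
    (f := fun ψ => sin (W.θ₁ + ψ)) (by fun_prop)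
  set s := sin (W.θ₁ + t) with hs
  have hs0 : 0 < s := sin_pos_of_pos_of_lt_pi (by linarith [ht.1, W.θ₁_pos])
    (by linarith [ht.2, W.contact_le_pi])
  -- a lower bound for all radii of curvature as long as `|u| ≤ 1`
  set l := radius g σ (-1) π with hldef
  have hl0 : 0 < l := (isProfile_radius hg hσ (by norm_num)).pos π
  have hbound : ∀ u ∈ Ioo (-1 : ℝ) 0, 1 / 2 * (l * m * s) *
      (√(σ / g) * (log (√(σ / g) * δ) - log (-u))) ≤ W.volumeAt g σ u := by
    intro u hu
    have hl := isProfile_radius hg hσ hu.2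
    have hlu : ∀ ψ, l ≤ radius g σ u ψ := fun ψ =>
      (radius_lt_radius hg hσ hu.1 hu.2 π).le.trans
        (hl.mono _ _ (by rw [cos_pi]; exact neg_one_le_cos ψ))
    have hcont := hl.cont.fun_mul (W.continuous_arcSupport hl.cont)
    have hnonneg : ∀ ψ ∈ Ioo W.ψ₂ W.ψ₁, 0 ≤ radius g σ u ψ * W.arcSupport (radius g σ u) ψ :=
      fun ψ hψ => (mul_pos (hl.pos ψ) (W.arcSupport_pos hl hψ)).le
    have h1 : ∫ ψ in 0..δ, radius g σ u ψ * W.arcSupport (radius g σ u) ψ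
        ≤ ∫ ψ in W.ψ₂..W.ψ₁, radius g σ u ψ * W.arcSupport (radius g σ u) ψ := by
      refine intervalIntegral.integral_mono_interval W.ψ₂_neg.le hδ.le hδ₁.le ?_
        (hcont.intervalIntegrable _ _)
      rw [← restrict_Ioo_eq_restrict_Ioc]
      exact (ae_restrict_iff' measurableSet_Ioo).2 (Eventually.of_forall hnonneg)
    have h2 : (l * m * s) * ∫ ψ in 0..δ, radius g σ u ψ
        ≤ ∫ ψ in 0..δ, radius g σ u ψ * W.arcSupport (radius g σ u) ψ := by
      rw [← intervalIntegral.integral_const_mul]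
      refine intervalIntegral.integral_mono_on hδ.le
        ((hl.cont.const_mul _).intervalIntegrable _ _) (hcont.intervalIntegrable _ _)
        fun ψ hψ => ?_
      rw [mul_comm]
      refine mul_le_mul_of_nonneg_left ?_ (hl.pos ψ).le
      refine le_trans ?_ (W.reach_mul_sin_le_arcSupport hl hψ.1 (hψ.2.trans hδ₁.le))
      exact mul_le_mul (hreach _ hl l hl0.le hlu) (htmin hψ) hs0.le (W.reach_pos hl).le
    have h3 := mul_le_mul_of_nonneg_left (le_integral_radius hg hσ hu.2 hδ)
      (mul_pos (mul_pos hl0 hm) hs0).le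
    unfold volumeAt arcArea
    rw [mul_assoc]
    exact mul_le_mul_of_nonneg_left ((h3.trans h2).trans h1) (by norm_num)
  have hneg : Tendsto (fun u : ℝ => -u) (𝓝[<] 0) (𝓝[>] 0) := by
    simpa using tendsto_neg_nhdsLT (a := (0 : ℝ))
  have hlog : Tendsto (fun u : ℝ => log (√(σ / g) * δ) - log (-u)) (𝓝[<] 0) atTop := by
    simp only [sub_eq_add_neg]
    exact tendsto_atTop_add_const_left _ _
      (tendsto_neg_atBot_atTop.comp (tendsto_log_nhdsGT_zero.comp hneg))
  have hk : 0 < √(σ / g) := sqrt_pos.2 (div_pos hσ hg)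
  have hC : 0 < 1 / 2 * (l * m * s) :=
    mul_pos (by norm_num) (mul_pos (mul_pos hl0 hm) hs0)
  refine tendsto_atTop_mono' _ ?_ ((hlog.const_mul_atTop hk).const_mul_atTop hC)
  filter_upwards [Ioo_mem_nhdsLT (show (-1 : ℝ) < 0 by norm_num)] with u hu
  exact hbound u hu

theorem exists_volumeAt_eq (hg : 0 < g) (hσ : 0 < σ) {V : ℝ} (hV : 0 < V) :
    ∃ um < 0, W.volumeAt g σ um = V := by
  obtain ⟨a, haV, ha⟩ := (((W.tendsto_volumeAt_atBot hg hσ).eventually_lt_const hV).and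
    (eventually_lt_atBot 0)).exists
  obtain ⟨b, hbV, hb⟩ := (((W.tendsto_volumeAt_nhdsLT_zero hg hσ).eventually_ge_atTop V).and
    self_mem_nhdsWithin).exists
  exact isPreconnected_Iio.intermediate_value (mem_Iio.2 ha) hb
    (W.continuousOn_volumeAt hg hσ) ⟨haV.le, hbV⟩

end Wedge

/-! ### Vertical shifts -/

theorem SolvesSurfaceODE.shift {g σ ψ₁ ψ₂ : ℝ} {x y : ℝ → ℝ} (hg : g ≠ 0)
    (h : SolvesSurfaceODE g σ 0 ψ₁ ψ₂ x y) (P : ℝ) :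
    SolvesSurfaceODE g σ P ψ₁ ψ₂ x fun ψ => y ψ + P / g := by
  intro ψ hψ
  have e : g * (y ψ + P / g) - P = g * y ψ - 0 := by field_simp; ring
  obtain ⟨h1, h2, h3⟩ := h ψ hψ
  simp only [e]
  exact ⟨h1, h2, h3.add_const _⟩

theorem MeetsWalls.shift {g θ₁ θ₂ ψ₁ ψ₂ P : ℝ} {x y : ℝ → ℝ}
    (h : MeetsWalls θ₁ θ₂ ψ₁ ψ₂ (-P / g) x y) :
    MeetsWalls θ₁ θ₂ ψ₁ ψ₂ 0 x fun ψ => y ψ + P / g := by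
  obtain ⟨⟨s, hs, h1, h2⟩, t, ht, h3, h4⟩ := h
  exact ⟨⟨s, hs, h1, by simp only [h2]; ring⟩, t, ht, h3, by simp only [h4]; ring⟩

end Capillary

theorem theorem1p2 (g σ κ θ₁ θ₂ : ℝ) (hg : 0 < g) (hσ : 0 < σ)
    (hκ : κ / σ ∈ Icc (-1 : ℝ) 1)
    (hθ₁ : θ₁ ∈ Ioo 0 Real.pi) (hθ₂ : θ₂ ∈ Ioo 0 Real.pi) (hθ : θ₁ + θ₂ < Real.pi)
    (ψ₁ ψ₂ : ℝ) (hψ₁ : ψ₁ = Capillary.leftAngle σ κ θ₁) (hψ₂ : ψ₂ = Capillary.rightAngle σ κ θ₂)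
    (hpos : 0 < ψ₁) (hneg : ψ₂ < 0) :
    -- the curve with data `(xm, um)` exists exactly for `um < 0`, and it is unique
    (∀ xm um : ℝ, (∃ x y : ℝ → ℝ, Capillary.IsShiftedCurve g σ ψ₁ ψ₂ xm um x y) ↔ um < 0) ∧
    (∀ (xm um : ℝ) (x y x' y' : ℝ → ℝ),
      Capillary.IsShiftedCurve g σ ψ₁ ψ₂ xm um x y →
      Capillary.IsShiftedCurve g σ ψ₁ ψ₂ xm um x' y' →
      EqOn x x' (Icc ψ₂ ψ₁) ∧ EqOn y y' (Icc ψ₂ ψ₁)) ∧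
    ∃ X P₀ 𝒱 : ℝ → ℝ,
      -- meeting the walls at the prescribed angles determines `xm`, the pressure and the volume
      -- as functions of `um`
      (∀ um < 0, 0 < 𝒱 um ∧ ∀ (xm : ℝ) (x y : ℝ → ℝ),
        Capillary.IsShiftedCurve g σ ψ₁ ψ₂ xm um x y → ∀ P : ℝ,
          (Capillary.MeetsWalls θ₁ θ₂ ψ₁ ψ₂ (-P / g) x y ↔ xm = X um ∧ P = P₀ um) ∧
          (Capillary.MeetsWalls θ₁ θ₂ ψ₁ ψ₂ (-P / g) x y →
            volume (Capillary.fluidRegion ψ₁ ψ₂ (-P / g) x y) = ENNReal.ofReal (𝒱 um))) ∧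
      -- asymptotics of the volume
      Tendsto 𝒱 (𝓝[<] 0) atTop ∧
      Tendsto 𝒱 atBot (𝓝 0) ∧
      -- existence for every prescribed volume; shifting back solves the original system
      (∀ V > 0, ∃ um < 0, 𝒱 um = V ∧ ∃ x y : ℝ → ℝ,
        Capillary.IsShiftedCurve g σ ψ₁ ψ₂ (X um) um x y ∧
        Capillary.MeetsWalls θ₁ θ₂ ψ₁ ψ₂ (-P₀ um / g) x y ∧
        volume (Capillary.fluidRegion ψ₁ ψ₂ (-P₀ um / g) x y) = ENNReal.ofReal V ∧
        Capillary.SolvesSurfaceODE g σ (P₀ um) ψ₁ ψ₂ x (fun ψ => y ψ + P₀ um / g) ∧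
        Capillary.MeetsWalls θ₁ θ₂ ψ₁ ψ₂ 0 x (fun ψ => y ψ + P₀ um / g)) ∧
      -- monotonicity and uniqueness for a negative jump
      (κ < 0 →
        StrictMonoOn 𝒱 (Iio 0) ∧
        ∀ V > 0, ∀ (xm um P xm' um' P' : ℝ) (x y x' y' : ℝ → ℝ),
          Capillary.IsShiftedCurve g σ ψ₁ ψ₂ xm um x y →
          Capillary.MeetsWalls θ₁ θ₂ ψ₁ ψ₂ (-P / g) x y →
          volume (Capillary.fluidRegion ψ₁ ψ₂ (-P / g) x y) = ENNReal.ofReal V →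
          Capillary.IsShiftedCurve g σ ψ₁ ψ₂ xm' um' x' y' →
          Capillary.MeetsWalls θ₁ θ₂ ψ₁ ψ₂ (-P' / g) x' y' →
          volume (Capillary.fluidRegion ψ₁ ψ₂ (-P' / g) x' y') = ENNReal.ofReal V →
          um = um' ∧ xm = xm' ∧ P = P' ∧
            EqOn x x' (Icc ψ₂ ψ₁) ∧ EqOn y y' (Icc ψ₂ ψ₁)) := by
  obtain ⟨W, rfl, rfl, rfl, rfl⟩ : ∃ W : Capillary.Wedge,
      θ₁ = W.θ₁ ∧ θ₂ = W.θ₂ ∧ ψ₁ = W.ψ₁ ∧ ψ₂ = W.ψ₂ := by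
    have hγ : Capillary.contactGamma σ κ ≤ Real.pi / 2 := Real.arcsin_le_pi_div_two _
    unfold Capillary.leftAngle at hψ₁
    unfold Capillary.rightAngle at hψ₂
    exact ⟨⟨θ₁, θ₂, ψ₁, ψ₂, hθ₁.1, hθ₂.1, hθ, hpos, hneg, by linarith, by linarith⟩,
      rfl, rfl, rfl, rfl⟩
  have hlt : ∀ {xm um : ℝ} {x y : ℝ → ℝ},
      Capillary.IsShiftedCurve g σ W.ψ₁ W.ψ₂ xm um x y → um < 0 := fun h =>
    h.neg hg hσ W.ψ₁_pos W.ψ₁_lt_pi W.ψ₂_neg.le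
  have huniq : ∀ (xm um : ℝ) (x y x' y' : ℝ → ℝ),
      Capillary.IsShiftedCurve g σ W.ψ₁ W.ψ₂ xm um x y →
      Capillary.IsShiftedCurve g σ W.ψ₁ W.ψ₂ xm um x' y' →
      EqOn x x' (Icc W.ψ₂ W.ψ₁) ∧ EqOn y y' (Icc W.ψ₂ W.ψ₁) := fun xm um x y x' y' h h' =>
    ⟨fun ψ hψ => (W.eq_arc_of_isShiftedCurve hg hσ h hψ).1.trans
        (W.eq_arc_of_isShiftedCurve hg hσ h' hψ).1.symm,
      fun ψ hψ => (W.eq_arc_of_isShiftedCurve hg hσ h hψ).2.trans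
        (W.eq_arc_of_isShiftedCurve hg hσ h' hψ).2.symm⟩
  have hvol : ∀ um < 0, 0 < W.volumeAt g σ um := fun um hum =>
    W.arcArea_pos (Capillary.isProfile_radius hg hσ hum)
  refine ⟨fun xm um => ⟨fun ⟨x, y, h⟩ => hlt h, fun hum => ⟨_, _, W.isShiftedCurve_arc hg hσ hum⟩⟩,
    huniq, W.apexX g σ, W.pressure g σ, W.volumeAt g σ,
    fun um hum => ⟨hvol um hum, fun xm x y h P =>
      ⟨W.meetsWalls_iff hg hσ h P, W.volume_fluidRegion hg hσ h⟩⟩,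
    W.tendsto_volumeAt_nhdsLT_zero hg hσ, W.tendsto_volumeAt_atBot hg hσ, ?_, ?_⟩
  · intro V hV
    obtain ⟨um, hum, hVeq⟩ := W.exists_volumeAt_eq hg hσ hV
    have hcurve := W.isShiftedCurve_arc (xm := W.apexX g σ um) hg hσ hum
    have hmeets := (W.meetsWalls_iff hg hσ hcurve _).2 ⟨rfl, rfl⟩
    exact ⟨um, hum, hVeq, _, _, hcurve, hmeets,
      by rw [W.volume_fluidRegion hg hσ hcurve hmeets, hVeq],
      hcurve.ode.shift hg.ne' _, hmeets.shift⟩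
  · intro _
    refine ⟨W.strictMonoOn_volumeAt hg hσ, ?_⟩
    intro V hV xm um P xm' um' P' x y x' y' h hm hv h' hm' hv'
    have heq : um = um' := by
      rw [W.volume_fluidRegion hg hσ h hm] at hv
      rw [W.volume_fluidRegion hg hσ h' hm', ← hv] at hv'
      exact ((W.strictMonoOn_volumeAt hg hσ).injOn (hlt h') (hlt h)
        ((ENNReal.ofReal_eq_ofReal_iff (hvol _ (hlt h')).le (hvol _ (hlt h)).le).1 hv')).symm
    subst heq
    obtain ⟨rfl, rfl⟩ := (W.meetsWalls_iff hg hσ h P).1 hm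
    obtain ⟨rfl, rfl⟩ := (W.meetsWalls_iff hg hσ h' P').1 hm'
    exact ⟨rfl, rfl, rfl, huniq _ _ _ _ _ _ h h'⟩
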